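/- Let $\Bbbk$ be a field. For a matroid $M$ on a finite ground set $S$, let $V(M)$ be the $\Bbbk$-vector space with basis $\{e_x : x\in S\}$, let $\partial$ be the (anti-)derivation of the exterior algebra $\Lambda(V(M))$ with $\partial(e_x)=1$ for all $x$, and let the Orlik–Solomon algebra $A(M)$ be the quotient of $\Lambda(V(M))$ by the ideal generated by the elements $\partial(e_{x_1}\cdots e_{x_k})$, for all circuits $\{x_1,\dots,x_k\}$ of $M$. It is graded with each $e_x$ in degree $1$. Let the projective Orlik–Solomon algebra $\overline{A}(M)$ be the graded subalgebra of $A(M)$ generated by the classes of the vectors $\sum_x v_x e_x$ with $\sum_x v_x=0$. Let $M_1$, $M_2$ be matroids on finite ground sets $S_1$, $S_2$ with $S_1\cap S_2=\{i\}$, where $i$ is a loop of neither $M_1$ nor $M_2$. Let $M_1\|_{i} M_2$ be their parallel connection, i.e. the matroid on $S_1\cup S_2$ whose circuits are the circuits of $M_1$, the circuits of $M_2$, and the sets $(C_1\setminus\{i\})\cup(C_2\setminus\{i\})$ where $C_1$ and $C_2$ are circuits of $M_1$ and $M_2$ that contain $i$. Let $M_1\oplus M_2$ be the direct sum, on the disjoint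 union $S_1\sqcup S_2$, let $i'$ denote the copy of $i$ in $S_2$, and let $\phi\colon S_1\sqcup S_2\to S_1\cup S_2$ be the identification map. Then: (1) $e_x\mapsto e_{\phi(x)}$ defines a homomorphism of graded algebras $A(\phi)\colon A(M_1\oplus M_2)\to A(M_1\|_{i} M_2)$, and there is a short exact sequence of graded vector spaces $$0\to A(M_1\|_{i} M_2)[-1]\xrightarrow{\ j\ } A(M_1\oplus M_2)\xrightarrow{A(\phi)} A(M_1\|_{i} M_2)\to 0,$$ where $j$, which raises degrees by $1$, is given by $j(A(\phi)(a))=(e_i-e_{i'})\,a$. (2) There is an isomorphism of graded algebras $\overline{A}(M_1)\otimes_{\Bbbk}\overline{A}(M_2)\cong\overline{A}(M_1\|_{i} M_2)$, where the tensor product is that of graded-commutative algebras, with $(a\otimes b)(c\otimes d)=(-1)^{\deg b\,\deg c}\,ac\otimes bd$. It is induced by $\phi$: it sends $a\otimes b$ to $f_1(a)f_2(b)$, where $f_k\colon A(M_k)\to A(M_1\|_{i} M_2)$ is the algebra homomorphism with $e_x\mapsto e_x$ for $x\in S_k$. -/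

import Mathlib

open scoped TensorProduct

universe u v

namespace ParallelConnection

variable {α : Type u}

/-- The circuits of the parallel connection of `M₁` and `M₂` along the single common
element `i`: the circuits of `M₁`, the circuits of `M₂`, and the sets
`(C₁ - i) ∪ (C₂ - i)` where `C₁`, `C₂` are circuits of `M₁`, `M₂` through `i`. -/
def circuits (M₁ M₂ : Matroid α) (i : α) : Set (Set α) :=
  {C | M₁.IsCircuit C ∨ M₂.IsCircuit C ∨
    ∃ C₁ C₂ : Set α, M₁.IsCircuit C₁ ∧ M₂.IsCircuit C₂ ∧ i ∈ C₁ ∧ i ∈ C₂ ∧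
      C = (C₁ \ {i}) ∪ (C₂ \ {i})}

/-- A set is independent in the parallel connection if it contains none of its circuits. -/
def Indep (M₁ M₂ : Matroid α) (i : α) (I : Set α) : Prop :=
  I ⊆ M₁.E ∪ M₂.E ∧ ∀ C ∈ circuits M₁ M₂ i, ¬ C ⊆ I

theorem circuits_comm (M₁ M₂ : Matroid α) (i : α) : circuits M₁ M₂ i = circuits M₂ M₁ i := by
  ext C
  simp only [circuits, Set.mem_ofPred_eq]
  constructor
  all_goals
    rintro (h | h | ⟨C₁, C₂, h₁, h₂, h₃, h₄, rfl⟩)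
    · exact Or.inr (Or.inl h)
    · exact Or.inl h
    · exact Or.inr (Or.inr ⟨C₂, C₁, h₂, h₁, h₄, h₃, Set.union_comm _ _⟩)

theorem indep_iff {M₁ M₂ : Matroid α} {i : α} (h₁ : M₁.IsNonloop i) (h₂ : M₂.IsNonloop i)
    (I : Set α) :
    Indep M₁ M₂ i I ↔ I ⊆ M₁.E ∪ M₂.E ∧
      ((M₁.Indep (I ∩ M₁.E) ∧ M₂.Indep (insert i I ∩ M₂.E)) ∨
        (M₁.Indep (insert i I ∩ M₁.E) ∧ M₂.Indep (I ∩ M₂.E))) := by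
  refine and_congr_right fun hI => ?_
  have e₁ := h₁.mem_ground
  have e₂ := h₂.mem_ground
  constructor
  · intro h
    have key : ∀ N : Matroid α, i ∈ N.E → (∀ C, N.IsCircuit C → ¬ C ⊆ I) →
        ¬ N.Indep (insert i I ∩ N.E) →
        ∃ C, N.IsCircuit C ∧ i ∈ C ∧ C \ {i} ⊆ I := by
      intro N hiN hN hd
      obtain ⟨C, hC, hcirc⟩ := Matroid.Dep.exists_isCircuit_subset
        ((Matroid.not_indep_iff (M := N)).1 hd)
      have hC' : C \ {i} ⊆ I := by
        rintro x ⟨hx, hxi⟩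
        exact ((hC hx).1).resolve_left hxi
      refine ⟨C, hcirc, ?_, hC'⟩
      by_contra hiC
      exact hN C hcirc fun x hx => hC' ⟨hx, fun hxi => hiC (hxi ▸ hx)⟩
    have a₁ : ∀ C, M₁.IsCircuit C → ¬ C ⊆ I := fun C hC => h C (Or.inl hC)
    have a₂ : ∀ C, M₂.IsCircuit C → ¬ C ⊆ I := fun C hC => h C (Or.inr (Or.inl hC))
    have b₁ : M₁.Indep (I ∩ M₁.E) := by
      rw [Matroid.indep_iff_forall_subset_not_isCircuit]
      exact fun C hC hc => a₁ C hc (hC.trans Set.inter_subset_left)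
    have b₂ : M₂.Indep (I ∩ M₂.E) := by
      rw [Matroid.indep_iff_forall_subset_not_isCircuit]
      exact fun C hC hc => a₂ C hc (hC.trans Set.inter_subset_left)
    by_contra! hcon
    have c₂ := hcon.1 b₁
    have c₁ : ¬ M₁.Indep (insert i I ∩ M₁.E) := fun hh => hcon.2 hh b₂
    obtain ⟨C₁, hC₁, hi₁, hs₁⟩ := key M₁ e₁ a₁ c₁
    obtain ⟨C₂, hC₂, hi₂, hs₂⟩ := key M₂ e₂ a₂ c₂
    exact h _ (Or.inr (Or.inr ⟨C₁, C₂, hC₁, hC₂, hi₁, hi₂, rfl⟩)) (Set.union_subset hs₁ hs₂)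
  · intro h
    have b : M₁.Indep (I ∩ M₁.E) ∧ M₂.Indep (I ∩ M₂.E) := by
      rcases h with h | h
      · exact ⟨h.1, h.2.subset (Set.inter_subset_inter_left _ (Set.subset_insert _ _))⟩
      · exact ⟨h.1.subset (Set.inter_subset_inter_left _ (Set.subset_insert _ _)), h.2⟩
    rintro C (hC | hC | ⟨C₁, C₂, hC₁, hC₂, hi₁, hi₂, rfl⟩) hCI
    · exact hC.not_indep (b.1.subset (Set.subset_inter hCI hC.subset_ground))
    · exact hC.not_indep (b.2.subset (Set.subset_inter hCI hC.subset_ground))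
    · have s₁ : C₁ ⊆ insert i I := fun x hx => by
        by_cases hxi : x = i
        · exact Or.inl hxi
        · exact Or.inr (hCI (Or.inl ⟨hx, hxi⟩))
      have s₂ : C₂ ⊆ insert i I := fun x hx => by
        by_cases hxi : x = i
        · exact Or.inl hxi
        · exact Or.inr (hCI (Or.inr ⟨hx, hxi⟩))
      rcases h with h | h
      · exact hC₂.not_indep (h.2.subset (Set.subset_inter s₂ hC₂.subset_ground))
      · exact hC₁.not_indep (h.1.subset (Set.subset_inter s₁ hC₁.subset_ground))

theorem card_aux {M₁ M₂ : Matroid α} [M₁.Finite] [M₂.Finite] {i : α}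
    (hE : M₁.E ∩ M₂.E = {i}) {I : Set α} (hI : I ⊆ M₁.E ∪ M₂.E) :
    (I ∩ M₁.E).ncard + (insert i I ∩ M₂.E).ncard = I.ncard + 1 := by
  have e : i ∈ M₁.E ∩ M₂.E := hE ▸ rfl
  have hu : ∀ x, x ∈ M₁.E → x ∈ M₂.E → x = i := fun x h₁ h₂ => by
    have : x ∈ M₁.E ∩ M₂.E := ⟨h₁, h₂⟩
    rwa [hE] at this
  have f₁ : (I ∩ M₁.E).Finite := M₁.ground_finite.subset Set.inter_subset_right
  have f₂ : (insert i I ∩ M₂.E).Finite := M₂.ground_finite.subset Set.inter_subset_right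
  have fI : I.Finite := (M₁.ground_finite.union M₂.ground_finite).subset hI
  rw [← Set.ncard_union_add_ncard_inter _ _ f₁ f₂]
  have hun : (I ∩ M₁.E) ∪ (insert i I ∩ M₂.E) = insert i I := by
    ext x
    constructor
    · rintro (h | h)
      · exact Or.inr h.1
      · exact h.1
    · rintro (rfl | h)
      · exact Or.inr ⟨Or.inl rfl, e.2⟩
      · rcases hI h with h' | h'
        · exact Or.inl ⟨h, h'⟩
        · exact Or.inr ⟨Or.inr h, h'⟩
  rw [hun]
  by_cases hi : i ∈ I
  · have hin : (I ∩ M₁.E) ∩ (insert i I ∩ M₂.E) = {i} := by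
      ext x
      constructor
      · rintro ⟨h, h'⟩
        exact hu x h.2 h'.2
      · rintro rfl
        exact ⟨⟨hi, e.1⟩, Or.inl rfl, e.2⟩
    rw [hin, Set.insert_eq_of_mem hi, Set.ncard_singleton]
  · have hin : (I ∩ M₁.E) ∩ (insert i I ∩ M₂.E) = ∅ := by
      ext x
      simp only [Set.mem_empty_iff_false, iff_false]
      rintro ⟨h, h'⟩
      exact hi (hu x h.2 h'.2 ▸ h.1)
    rw [hin, Set.ncard_empty, Set.ncard_insert_of_notMem hi fI]

theorem augment_aux {M₁ M₂ : Matroid α} [M₁.Finite] [M₂.Finite] {i : α}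
    (hE : M₁.E ∩ M₂.E = {i}) {I J A₁ A₂ : Set α}
    (hI₁ : M₁.Indep (I ∩ M₁.E)) (hI₂ : M₂.Indep (insert i I ∩ M₂.E))
    (hA₁ : M₁.Indep A₁) (hA₂ : M₂.Indep A₂) (hAJ₁ : A₁ ⊆ insert i J) (hAJ₂ : A₂ ⊆ insert i J)
    (hc : (I ∩ M₁.E).ncard + (insert i I ∩ M₂.E).ncard < A₁.ncard + A₂.ncard) :
    (∃ e ∈ J, e ∉ I ∧ M₁.Indep (insert e I ∩ M₁.E) ∧ M₂.Indep (insert i (insert e I) ∩ M₂.E)) ∨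
      (M₁.Indep (insert i I ∩ M₁.E) ∧ i ∉ I ∧ i ∈ A₁) := by
  have e : i ∈ M₁.E ∩ M₂.E := hE ▸ rfl
  have hu : ∀ x, x ∈ M₁.E → x ∈ M₂.E → x = i := fun x h₁ h₂ => by
    have : x ∈ M₁.E ∩ M₂.E := ⟨h₁, h₂⟩
    rwa [hE] at this
  have aug : ∀ N : Matroid α, N.Finite → ∀ X Y : Set α, N.Indep X → N.Indep Y →
      X.ncard < Y.ncard → ∃ x ∈ Y \ X, N.Indep (insert x X) := by
    intro N hN X Y hX hY hXY
    have fX : X.Finite := N.ground_finite.subset hX.subset_ground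
    have fY : Y.Finite := N.ground_finite.subset hY.subset_ground
    refine hX.augment hY ?_
    rw [← fX.cast_ncard_eq, ← fY.cast_ncard_eq]
    exact_mod_cast hXY
  by_cases hlt : (I ∩ M₁.E).ncard < A₁.ncard
  · obtain ⟨x, ⟨hxA, hxI⟩, hx⟩ := aug M₁ ‹_› _ _ hI₁ hA₁ hlt
    have hxE : x ∈ M₁.E := hA₁.subset_ground hxA
    have hxI' : x ∉ I := fun h => hxI ⟨h, hxE⟩
    rw [Set.insert_inter_of_mem hxE |>.symm] at hx
    by_cases hxi : x = i
    · subst hxi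
      exact Or.inr ⟨hx, hxI', hxA⟩
    · refine Or.inl ⟨x, (hAJ₁ hxA).resolve_left hxi, hxI', hx, ?_⟩
      have hx₂ : x ∉ M₂.E := fun h => hxi (hu x hxE h)
      rwa [Set.insert_comm, Set.insert_inter_of_notMem hx₂]
  · obtain ⟨x, ⟨hxA, hxI⟩, hx⟩ := aug M₂ ‹_› _ _ hI₂ hA₂ (by omega)
    have hxE : x ∈ M₂.E := hA₂.subset_ground hxA
    have hxi : x ≠ i := by
      rintro rfl
      exact hxI ⟨Or.inl rfl, hxE⟩
    have hx₁ : x ∉ M₁.E := fun h => hxi (hu x h hxE)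
    refine Or.inl ⟨x, (hAJ₂ hxA).resolve_left hxi, fun h => hxI ⟨Or.inr h, hxE⟩, ?_, ?_⟩
    · rwa [Set.insert_inter_of_notMem hx₁]
    · rwa [Set.insert_comm, Set.insert_inter_of_mem hxE]

theorem augment {M₁ M₂ : Matroid α} [M₁.Finite] [M₂.Finite] {i : α}
    (hE : M₁.E ∩ M₂.E = {i}) {I J : Set α} (hI : I ⊆ M₁.E ∪ M₂.E) (hJ : J ⊆ M₁.E ∪ M₂.E)
    (hI₁ : M₁.Indep (I ∩ M₁.E)) (hI₂ : M₂.Indep (insert i I ∩ M₂.E))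
    (hJ' : (M₁.Indep (J ∩ M₁.E) ∧ M₂.Indep (insert i J ∩ M₂.E)) ∨
      (M₁.Indep (insert i J ∩ M₁.E) ∧ M₂.Indep (J ∩ M₂.E)))
    (hc : I.ncard < J.ncard) :
    ∃ e ∈ J, e ∉ I ∧
      ((M₁.Indep (insert e I ∩ M₁.E) ∧ M₂.Indep (insert i (insert e I) ∩ M₂.E)) ∨
        (M₁.Indep (insert i (insert e I) ∩ M₁.E) ∧ M₂.Indep (insert e I ∩ M₂.E))) := by
  have hE' : M₂.E ∩ M₁.E = {i} := by rw [Set.inter_comm, hE]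
  have hI' : I ⊆ M₂.E ∪ M₁.E := by rwa [Set.union_comm]
  have hJ₀ : J ⊆ M₂.E ∪ M₁.E := by rwa [Set.union_comm]
  have cI := card_aux hE hI
  have cI' := card_aux hE' hI'
  have cJ := card_aux hE hJ
  have cJ' := card_aux hE' hJ₀
  have sub : ∀ E : Set α, J ∩ E ⊆ insert i J := fun E x hx => Or.inr hx.1
  have sub' : ∀ E : Set α, insert i J ∩ E ⊆ insert i J := fun E x hx => hx.1
  rcases hJ' with ⟨hJ₁, hJ₂⟩ | ⟨hJ₁, hJ₂⟩
  · rcases augment_aux (J := J) hE hI₁ hI₂ hJ₁ hJ₂ (sub _) (sub' _) (by omega) with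
      ⟨e, heJ, heI, h⟩ | ⟨h, hiI, hiJ⟩
    · exact ⟨e, heJ, heI, Or.inl h⟩
    · refine ⟨i, hiJ.1, hiI, Or.inl ⟨h, ?_⟩⟩
      rwa [Set.insert_idem]
  · rcases augment_aux (J := J) hE hI₁ hI₂ hJ₁ hJ₂ (sub' _) (sub _) (by omega) with
      ⟨e, heJ, heI, h⟩ | ⟨h, hiI, hiJ⟩
    · exact ⟨e, heJ, heI, Or.inl h⟩
    · have hI₂' : M₂.Indep (I ∩ M₂.E) :=
        hI₂.subset (Set.inter_subset_inter_left _ (Set.subset_insert _ _))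
      rcases augment_aux (J := J) hE' hI₂' h hJ₂ hJ₁ (sub _) (sub' _) (by omega) with
        ⟨e, heJ, heI, h'⟩ | ⟨h', -, hiJ'⟩
      · exact ⟨e, heJ, heI, Or.inr ⟨h'.2, h'.1⟩⟩
      · refine ⟨i, hiJ'.1, hiI, Or.inr ⟨?_, h'⟩⟩
        rwa [Set.insert_idem]

end ParallelConnection

/-- The parallel connection of two finite matroids whose ground sets meet in the single
element `i`, which is a loop of neither; its ground set is `M₁.E ∪ M₂.E`. -/
def parallelConnection {α : Type u} (M₁ M₂ : Matroid α) [M₁.Finite] [M₂.Finite] (i : α)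
    (hE : M₁.E ∩ M₂.E = {i}) (h₁ : M₁.IsNonloop i) (h₂ : M₂.IsNonloop i) : Matroid α :=
  (IndepMatroid.ofFinite (E := M₁.E ∪ M₂.E) (M₁.ground_finite.union M₂.ground_finite)
    (ParallelConnection.Indep M₁ M₂ i)
    (by
      rw [ParallelConnection.indep_iff h₁ h₂]
      refine ⟨Set.empty_subset _, Or.inl ⟨by simp, ?_⟩⟩
      exact h₂.indep.subset (by simp))
    (fun _ _ hJ hIJ => ⟨hIJ.trans hJ.1, fun C hC hCI => hJ.2 C hC (hCI.trans hIJ)⟩)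
    (by
      intro I J hI hJ hc
      rw [ParallelConnection.indep_iff h₁ h₂] at hI hJ
      have hins : ∀ e ∈ J, insert e I ⊆ M₁.E ∪ M₂.E := fun e he =>
        Set.insert_subset (hJ.1 he) hI.1
      rcases hI.2 with ⟨a, b⟩ | ⟨a, b⟩
      · obtain ⟨e, he, heI, h⟩ := ParallelConnection.augment hE hI.1 hJ.1 a b hJ.2 hc
        exact ⟨e, he, heI, (ParallelConnection.indep_iff h₁ h₂ _).2 ⟨hins e he, h⟩⟩
      · obtain ⟨e, he, heI, h⟩ := ParallelConnection.augment (M₁ := M₂) (M₂ := M₁) (i := i)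
          (by rw [Set.inter_comm, hE]) (by rw [Set.union_comm]; exact hI.1)
          (by rw [Set.union_comm]; exact hJ.1) b a (hJ.2.symm.imp And.symm And.symm) hc
        exact ⟨e, he, heI, (ParallelConnection.indep_iff h₁ h₂ _).2
          ⟨hins e he, h.symm.imp And.symm And.symm⟩⟩)
    (fun _ hI => hI.1)).matroid

namespace ParallelConnection

variable {α : Type u} {M₁ M₂ : Matroid α} [M₁.Finite] [M₂.Finite] {i : α}
  (hE : M₁.E ∩ M₂.E = {i}) (h₁ : M₁.IsNonloop i) (h₂ : M₂.IsNonloop i)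

/-- The inclusion of the ground set of `M₁` in that of the parallel connection. -/
def inclLeft (x : M₁.E) : (parallelConnection M₁ M₂ i hE h₁ h₂).E :=
  ⟨x.1, Or.inl x.2⟩

/-- The inclusion of the ground set of `M₂` in that of the parallel connection. -/
def inclRight (x : M₂.E) : (parallelConnection M₁ M₂ i hE h₁ h₂).E :=
  ⟨x.1, Or.inr x.2⟩

/-- The identification map `φ` from the disjoint union of the two ground sets (the ground
set of the direct sum) to their union, which glues the two copies of `i`. -/
def identify (x : (M₁.sum M₂).E) : (parallelConnection M₁ M₂ i hE h₁ h₂).E :=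
  ⟨Sum.elim id id x.1, by
    obtain ⟨y, hy⟩ := x
    rw [Matroid.sum_ground] at hy
    rcases hy with ⟨z, hz, rfl⟩ | ⟨z, hz, rfl⟩
    · exact Or.inl hz
    · exact Or.inr hz⟩

/-- An element of `M₁`, as an element of the direct sum. -/
def sumLeft (M₂ : Matroid α) (x : M₁.E) : (M₁.sum M₂).E :=
  ⟨Sum.inl x.1, by rw [Matroid.sum_ground]; exact Or.inl ⟨x.1, x.2, rfl⟩⟩

/-- An element of `M₂`, as an element of the direct sum. -/
def sumRight (M₁ : Matroid α) (x : M₂.E) : (M₁.sum M₂).E :=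
  ⟨Sum.inr x.1, by rw [Matroid.sum_ground]; exact Or.inr ⟨x.1, x.2, rfl⟩⟩

end ParallelConnection

namespace OrlikSolomon

variable (𝕜 : Type v) [Field 𝕜] {α : Type u} (M : Matroid α)

/-- The vector space with basis `e_x`, for `x` in the ground set of `M`. -/
abbrev V : Type (max u v) := M.E →₀ 𝕜

/-- The exterior algebra of `V`. -/
abbrev E : Type (max u v) := ExteriorAlgebra 𝕜 (V 𝕜 M)

/-- The linear form on `V` that takes the value `1` on each `e_x`, i.e. the sum of the
coordinates. -/
noncomputable def coordSum : V 𝕜 M →ₗ[𝕜] 𝕜 :=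
  Finsupp.linearCombination 𝕜 (fun _ : M.E => (1 : 𝕜))

/-- The (anti-)derivation `∂` of the exterior algebra with `∂ e_x = 1` for all `x`. -/
noncomputable def partialE : E 𝕜 M →ₗ[𝕜] E 𝕜 M :=
  CliffordAlgebra.contractLeft (coordSum 𝕜 M)

/-- The monomial `e_{x₁} ⋯ e_{xₖ}` of a list of elements of the ground set. -/
noncomputable def monomial (l : List M.E) : E 𝕜 M :=
  (l.map fun x => ExteriorAlgebra.ι 𝕜 (Finsupp.single x (1 : 𝕜))).prod

/-- The relations of the Orlik-Solomon algebra: `∂ (e_C) = 0` for each circuit `C`. Every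
listing of the elements of `C` is used; another order changes `e_C` only by a sign. -/
inductive Rel : E 𝕜 M → E 𝕜 M → Prop
  | circuit (l : List M.E) (hl : l.Nodup) (hC : M.IsCircuit {a | ∃ x ∈ l, x.1 = a}) :
      Rel (partialE 𝕜 M (monomial 𝕜 M l)) 0

/-- The Orlik-Solomon algebra `A(M)`, the quotient of the exterior algebra by the ideal
generated by the elements `∂ (e_C)`. -/
abbrev A : Type (max u v) := RingQuot (Rel 𝕜 M)

/-- The quotient map from the exterior algebra onto `A(M)`. -/
noncomputable def mk : E 𝕜 M →ₐ[𝕜] A 𝕜 M := RingQuot.mkAlgHom 𝕜 (Rel 𝕜 M)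

/-- The class of `e_x` in `A(M)`. -/
noncomputable def gen (x : M.E) : A 𝕜 M :=
  mk 𝕜 M (ExteriorAlgebra.ι 𝕜 (Finsupp.single x (1 : 𝕜)))

/-- The degree `n` part of `A(M)`. -/
noncomputable def grading (n : ℕ) : Submodule 𝕜 (A 𝕜 M) :=
  (⋀[𝕜]^n (V 𝕜 M)).map (mk 𝕜 M).toLinearMap

theorem mk_mem_grading {n : ℕ} {x : E 𝕜 M} (hx : x ∈ ⋀[𝕜]^n (V 𝕜 M)) :
    mk 𝕜 M x ∈ grading 𝕜 M n := ⟨x, hx, rfl⟩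

theorem ι_mem (v : V 𝕜 M) : ExteriorAlgebra.ι 𝕜 v ∈ ⋀[𝕜]^1 (V 𝕜 M) := by
  simpa only [pow_one] using LinearMap.mem_range_self _ v

instance gradedMonoid : SetLike.GradedMonoid (grading 𝕜 M) where
  one_mem := ⟨1, SetLike.GradedOne.one_mem, map_one (mk 𝕜 M)⟩
  mul_mem := by
    rintro i j _ _ ⟨x, hx, rfl⟩ ⟨y, hy, rfl⟩
    exact ⟨x * y, SetLike.GradedMul.mul_mem hx hy, map_mul (mk 𝕜 M) x y⟩

theorem monomial_mem (l : List M.E) : monomial 𝕜 M l ∈ ⋀[𝕜]^(l.length) (V 𝕜 M) := by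
  induction l with
  | nil => exact SetLike.GradedOne.one_mem
  | cons x l ih =>
    have := SetLike.GradedMul.mul_mem (A := fun i : ℕ => ⋀[𝕜]^i (V 𝕜 M))
      (ι_mem 𝕜 M (Finsupp.single x 1)) ih
    rw [List.length_cons, add_comm]
    exact this

theorem partial_monomial_mem (l : List M.E) :
    partialE 𝕜 M (monomial 𝕜 M l) ∈ ⋀[𝕜]^(l.length - 1) (V 𝕜 M) := by
  induction l with
  | nil =>
    have : partialE 𝕜 M (monomial 𝕜 M []) = 0 := CliffordAlgebra.contractLeft_one (Q := (0 : QuadraticForm 𝕜 (V 𝕜 M))) _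
    rw [this]
    exact Submodule.zero_mem _
  | cons x l ih =>
    have h : partialE 𝕜 M (monomial 𝕜 M (x :: l)) =
        coordSum 𝕜 M (Finsupp.single x 1) • monomial 𝕜 M l -
          ExteriorAlgebra.ι 𝕜 (Finsupp.single x (1 : 𝕜)) * partialE 𝕜 M (monomial 𝕜 M l) :=
      CliffordAlgebra.contractLeft_ι_mul (Q := (0 : QuadraticForm 𝕜 (V 𝕜 M))) _ _ _
    rw [h]
    refine Submodule.sub_mem _ (Submodule.smul_mem _ _ (monomial_mem 𝕜 M l)) ?_
    rcases l with _ | ⟨y, l⟩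
    · have : partialE 𝕜 M (monomial 𝕜 M []) = 0 := CliffordAlgebra.contractLeft_one (Q := (0 : QuadraticForm 𝕜 (V 𝕜 M))) _
      rw [this, mul_zero]
      exact Submodule.zero_mem _
    · have := SetLike.GradedMul.mul_mem (A := fun i : ℕ => ⋀[𝕜]^i (V 𝕜 M))
        (ι_mem 𝕜 M (Finsupp.single x 1)) ih
      rw [add_comm] at this
      exact this

/-- Auxiliary: the map from the exterior algebra to the graded pieces of `A(M)`. -/
noncomputable def decomposeE : E 𝕜 M →ₐ[𝕜] DirectSum ℕ fun n => grading 𝕜 M n :=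
  ExteriorAlgebra.lift 𝕜
    ⟨DirectSum.lof 𝕜 ℕ (fun n => grading 𝕜 M n) 1 ∘ₗ
      ((mk 𝕜 M).toLinearMap ∘ₗ ExteriorAlgebra.ι 𝕜).codRestrict _
        fun v => mk_mem_grading 𝕜 M (ι_mem 𝕜 M v),
      fun v => by
        rw [LinearMap.comp_apply, DirectSum.lof_eq_of, DirectSum.of_mul_of]
        refine DFinsupp.single_eq_zero.mpr (Subtype.ext ?_)
        change mk 𝕜 M (ExteriorAlgebra.ι 𝕜 v) * mk 𝕜 M (ExteriorAlgebra.ι 𝕜 v) = 0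
        rw [← map_mul, ExteriorAlgebra.ι_sq_zero, map_zero]⟩

theorem decomposeE_apply (n : ℕ) (x : E 𝕜 M) (hx : x ∈ ⋀[𝕜]^n (V 𝕜 M)) :
    decomposeE 𝕜 M x =
      DirectSum.of (fun n => grading 𝕜 M n) n ⟨mk 𝕜 M x, mk_mem_grading 𝕜 M hx⟩ := by
  induction hx using Submodule.pow_induction_on_left' with
  | algebraMap r =>
    rw [AlgHom.commutes, DirectSum.algebraMap_apply]
    congr 1
    exact Subtype.ext ((mk 𝕜 M).commutes r).symm
  | add x y i hx hy ihx ihy =>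
    rw [map_add, ihx, ihy, ← map_add]
    congr 1
    exact Subtype.ext (map_add (mk 𝕜 M) x y).symm
  | mem_mul m hm i x hx ih =>
    obtain ⟨v, rfl⟩ := hm
    have hv : decomposeE 𝕜 M (ExteriorAlgebra.ι 𝕜 v) =
        DirectSum.of (fun n => grading 𝕜 M n) 1
          ⟨mk 𝕜 M (ExteriorAlgebra.ι 𝕜 v), mk_mem_grading 𝕜 M (ι_mem 𝕜 M v)⟩ := by
      rw [decomposeE, ExteriorAlgebra.lift_ι_apply]
      rfl
    rw [map_mul, ih, hv, DirectSum.of_mul_of]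
    exact DirectSum.of_eq_of_gradedMonoid_eq
      (Sigma.subtype_ext (add_comm _ _) (map_mul (mk 𝕜 M) _ _).symm)

theorem decomposeE_rel ⦃x y : E 𝕜 M⦄ (h : Rel 𝕜 M x y) :
    decomposeE 𝕜 M x = decomposeE 𝕜 M y := by
  have h0 : mk 𝕜 M x = mk 𝕜 M y := RingQuot.mkAlgHom_rel 𝕜 h
  obtain ⟨l, hl, hC⟩ := h
  rw [decomposeE_apply 𝕜 M _ _ (partial_monomial_mem 𝕜 M l), map_zero]
  rw [map_zero] at h0
  exact DFinsupp.single_eq_zero.mpr (Subtype.ext h0)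

/-- The Orlik-Solomon algebra is a graded algebra. -/
noncomputable instance gradedAlgebra : GradedAlgebra (grading 𝕜 M) :=
  GradedAlgebra.ofAlgHom _
    (RingQuot.liftAlgHom 𝕜 ⟨decomposeE 𝕜 M, decomposeE_rel 𝕜 M⟩)
    (by
      refine RingQuot.ringQuot_ext' 𝕜 _ _ (ExteriorAlgebra.hom_ext ?_)
      ext x
      simp only [LinearMap.comp_apply, AlgHom.toLinearMap_apply, AlgHom.comp_apply,
        AlgHom.id_apply, RingQuot.liftAlgHom_mkAlgHom_apply, Finsupp.lsingle_apply]
      rw [decomposeE_apply 𝕜 M 1 _ (ι_mem 𝕜 M _), DirectSum.coeAlgHom_of]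
      rfl)
    (by
      rintro n ⟨_, x, hx, rfl⟩
      exact (RingQuot.liftAlgHom_mkAlgHom_apply 𝕜 _ _ x).trans (decomposeE_apply 𝕜 M n x hx))

/-- The projective Orlik-Solomon algebra: the subalgebra of `A(M)` generated by the
vectors of `V` whose coordinates sum to zero. -/
noncomputable def projective : Subalgebra 𝕜 (A 𝕜 M) :=
  Algebra.adjoin 𝕜
    {a | ∃ v : V 𝕜 M, coordSum 𝕜 M v = 0 ∧ mk 𝕜 M (ExteriorAlgebra.ι 𝕜 v) = a}

/-- The degree `n` part of the projective Orlik-Solomon algebra. -/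
noncomputable def projGrading (n : ℕ) : Submodule 𝕜 (projective 𝕜 M) :=
  (grading 𝕜 M n).comap (projective 𝕜 M).val.toLinearMap

theorem decompose_mem_projective {a : A 𝕜 M} (ha : a ∈ projective 𝕜 M) (n : ℕ) :
    (DirectSum.decompose (grading 𝕜 M) a n : A 𝕜 M) ∈ projective 𝕜 M := by
  induction ha using Algebra.adjoin_induction generalizing n with
  | mem x hx =>
    have hx' : x ∈ grading 𝕜 M 1 := by
      obtain ⟨v, -, rfl⟩ := hx
      exact mk_mem_grading 𝕜 M (ι_mem 𝕜 M v)
    by_cases hn : n = 1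
    · subst hn
      rw [DirectSum.decompose_of_mem_same _ hx']
      exact Algebra.subset_adjoin hx
    · rw [DirectSum.decompose_of_mem_ne _ hx' (Ne.symm hn)]
      exact zero_mem _
  | algebraMap r =>
    have hr : algebraMap 𝕜 (A 𝕜 M) r ∈ grading 𝕜 M 0 := SetLike.algebraMap_mem_graded _ _
    by_cases hn : n = 0
    · subst hn
      rw [DirectSum.decompose_of_mem_same _ hr]
      exact (projective 𝕜 M).algebraMap_mem r
    · rw [DirectSum.decompose_of_mem_ne _ hr (Ne.symm hn)]
      exact zero_mem _
  | add x y _ _ ihx ihy =>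
    rw [DirectSum.decompose_add, DirectSum.add_apply, Submodule.coe_add]
    exact add_mem (ihx n) (ihy n)
  | mul x y _ _ ihx ihy =>
    classical
    rw [DirectSum.decompose_mul, DirectSum.coe_mul_apply]
    exact sum_mem fun p _ => mul_mem (ihx _) (ihy _)

instance projGradedMonoid : SetLike.GradedMonoid (projGrading 𝕜 M) where
  one_mem := SetLike.GradedOne.one_mem (A := grading 𝕜 M)
  mul_mem := fun _ _ _ _ hx hy => SetLike.GradedMul.mul_mem (A := grading 𝕜 M) hx hy

open Classical in
/-- Auxiliary: the homogeneous components of an element of the projective algebra. -/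
noncomputable def projDecompose (a : projective 𝕜 M) :
    DirectSum ℕ fun n => projGrading 𝕜 M n :=
  DirectSum.mk (fun n => projGrading 𝕜 M n)
    (DFinsupp.support (DirectSum.decompose (grading 𝕜 M) (a : A 𝕜 M)))
    fun n => ⟨⟨DirectSum.decompose (grading 𝕜 M) (a : A 𝕜 M) n,
      decompose_mem_projective 𝕜 M a.2 n⟩,
      (DirectSum.decompose (grading 𝕜 M) (a : A 𝕜 M) n).2⟩

open Classical in
theorem projDecompose_apply (a : projective 𝕜 M) (n : ℕ) :
    ((projDecompose 𝕜 M a n : projective 𝕜 M) : A 𝕜 M) =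
      DirectSum.decompose (grading 𝕜 M) (a : A 𝕜 M) n := by
  by_cases h : n ∈ DFinsupp.support (DirectSum.decompose (grading 𝕜 M) (a : A 𝕜 M))
  · rw [projDecompose, DirectSum.mk_apply_of_mem h]
  · rw [projDecompose, DirectSum.mk_apply_of_notMem h]
    rw [DFinsupp.notMem_support_iff] at h
    rw [h]
    rfl

/-- Auxiliary: the inclusion of the graded pieces of the projective algebra. -/
noncomputable def projIncl :
    (DirectSum ℕ fun n => projGrading 𝕜 M n) →+ DirectSum ℕ fun n => grading 𝕜 M n :=
  DirectSum.map fun _ =>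
    { toFun := fun x => ⟨((x : projective 𝕜 M) : A 𝕜 M), x.2⟩
      map_zero' := rfl
      map_add' := fun _ _ => rfl }

theorem projIncl_apply (y : DirectSum ℕ fun n => projGrading 𝕜 M n) (n : ℕ) :
    (projIncl 𝕜 M y n : A 𝕜 M) = ((y n : projective 𝕜 M) : A 𝕜 M) := by
  rw [projIncl, DirectSum.map_apply]
  rfl

theorem coe_projIncl (y : DirectSum ℕ fun n => projGrading 𝕜 M n) :
    DirectSum.coeAddMonoidHom (grading 𝕜 M) (projIncl 𝕜 M y) =
      (DirectSum.coeAddMonoidHom (projGrading 𝕜 M) y : projective 𝕜 M) := by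
  induction y using DirectSum.induction_on with
  | zero => simp
  | of n x =>
    rw [projIncl, DirectSum.map_of, DirectSum.coeAddMonoidHom_of, DirectSum.coeAddMonoidHom_of]
    rfl
  | add x y hx hy => rw [map_add, map_add, map_add, hx, hy, AddMemClass.coe_add]

theorem projIncl_projDecompose (a : projective 𝕜 M) :
    projIncl 𝕜 M (projDecompose 𝕜 M a) = DirectSum.decompose (grading 𝕜 M) (a : A 𝕜 M) := by
  refine DFinsupp.ext fun n => Subtype.ext ?_
  exact (projIncl_apply 𝕜 M _ n).trans (projDecompose_apply 𝕜 M a n)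

/-- The projective Orlik-Solomon algebra is a graded algebra. -/
noncomputable instance projGradedAlgebra : GradedAlgebra (projGrading 𝕜 M) where
  toGradedMonoid := projGradedMonoid 𝕜 M
  decompose' := projDecompose 𝕜 M
  left_inv a := by
    refine Subtype.ext ?_
    rw [← coe_projIncl, projIncl_projDecompose]
    exact (DirectSum.decompose (grading 𝕜 M)).symm_apply_apply (a : A 𝕜 M)
  right_inv y := by
    refine DFinsupp.ext fun n => Subtype.ext (Subtype.ext ?_)
    refine (projDecompose_apply 𝕜 M _ n).trans ?_
    rw [← coe_projIncl, ← projIncl_apply]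
    have := (DirectSum.decompose (grading 𝕜 M)).apply_symm_apply (projIncl 𝕜 M y)
    exact congrArg (fun z => ((z n : grading 𝕜 M n) : A 𝕜 M)) this

end OrlikSolomon

/-! Homomorphisms out of `A 𝕜 M` correspond to families of anticommuting, square-zero elements
satisfying the circuit relations (`IsOSFamily`), so maps are built and compared on generators. A
circuit relation through `i` rewrites `e_A` as `e_i ∂e_A`. Two such relations cancel in the Leibniz
expansion of `∂(e_A e_A')`, so the mixed circuits of the parallel connection impose nothing new.
Hence (`isOSFamily_parallelConnection_iff`) its families are exactly those of both matroids with
anticommuting values: the description for the direct sum, with the two values at `i` identified.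

The other mechanism is translation: adding to all generators one square-zero `w` that anticommutes
with them leaves every `∂(e_C)` unchanged (`IsOSFamily.add_const`).

For (1), put `u = e_i - e_{i'}`. Translating the `M₂`-generators by `u` makes the two copies of `i`
agree, which gives a section `s` of `A(φ)`, and `u * s(A(φ) a) = u * a`. There is an antiderivation
`D` with value `1` on the `M₁`-generators and `0` on the `M₂`-generators. Since `D u = 1`, the
equation `u * a = 0` forces `a = u * D a`. With `j b = u * s b`, injectivity and exactness both
follow from this.

For (2), translation by `-e_i` makes the differences `e_x - e_i` a family in the projective algebra.
These differences vanish at `i`, so the families of the two tensor factors agree there and glue to a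
map out of the algebra of the parallel connection. Its restriction to the projective algebra inverts
`a ⊗ b ↦ f₁(a) f₂(b)`, because the differences generate. -/

namespace OrlikSolomon

/-! ### Signed partial products of anticommuting elements -/

section ListPartial

variable {ι B : Type*} [Ring B]

/-- The expression `∑ₖ (-1)ᵏ f x₀ ⋯ f xₖ₋₁ f xₖ₊₁ ⋯ f xₙ`, for `l = [x₀, …, xₙ]`. -/
def listPartial (f : ι → B) : List ι → B
  | [] => 0
  | x :: l => (l.map f).prod - f x * listPartial f l

theorem listPartial_cons (f : ι → B) (x : ι) (l : List ι) :
    listPartial f (x :: l) = (l.map f).prod - f x * listPartial f l := rfl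

theorem listPartial_congr {f g : ι → B} {l : List ι} (h : ∀ x ∈ l, f x = g x) :
    listPartial f l = listPartial g l := by
  induction l with
  | nil => rfl
  | cons x l ih =>
    have h' : ∀ y ∈ l, f y = g y := fun y hy => h y (List.mem_cons_of_mem _ hy)
    rw [listPartial_cons, listPartial_cons, ih h', h x List.mem_cons_self,
      List.map_congr_left h']

theorem listPartial_map {κ : Type*} (f : ι → B) (g : κ → ι) (l : List κ) :
    listPartial f (l.map g) = listPartial (fun x => f (g x)) l := by
  induction l with
  | nil => rfl
  | cons x l ih => simp [listPartial_cons, ih, Function.comp_def]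

theorem map_listPartial {B' : Type*} [Ring B'] (F : B →+* B') (f : ι → B) (l : List ι) :
    F (listPartial f l) = listPartial (fun x => F (f x)) l := by
  induction l with
  | nil => exact map_zero F
  | cons x l ih => simp [listPartial_cons, ih, map_list_prod, Function.comp_def]

/-- This is the graded Leibniz rule for `∂`; it needs no commutation between the values of `f`. -/
theorem listPartial_append (f : ι → B) (l l' : List ι) :
    listPartial f (l ++ l') =
      listPartial f l * (l'.map f).prod + (-1) ^ l.length * ((l.map f).prod * listPartial f l') := by
  induction l with
  | nil => simp [listPartial]
  | cons x l ih =>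
    have hc : f x * (-1) ^ l.length = (-1) ^ l.length * f x :=
      ((Commute.neg_one_left (f x)).pow_left _).eq.symm
    simp only [List.cons_append, listPartial_cons, ih, List.map_append, List.prod_append,
      List.map_cons, List.prod_cons, List.length_cons, pow_succ, mul_add, sub_mul, ← mul_assoc, hc]
    noncomm_ring

theorem mul_prod_of_anticomm {f : ι → B} {z : B} {l : List ι}
    (h : ∀ x ∈ l, z * f x = -(f x * z)) :
    z * (l.map f).prod = (-1) ^ l.length * ((l.map f).prod * z) := by
  induction l with
  | nil => simp
  | cons x l ih =>
    have hc : f x * (-1) ^ l.length = (-1) ^ l.length * f x :=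
      ((Commute.neg_one_left (f x)).pow_left _).eq.symm
    rw [List.map_cons, List.prod_cons, ← mul_assoc, h x List.mem_cons_self, neg_mul, mul_assoc,
      ih fun y hy => h y (List.mem_cons_of_mem _ hy), ← mul_assoc, hc, List.length_cons, pow_succ]
    noncomm_ring

/-- The terms of `listPartial f l` have one factor fewer than `l`, whence the extra minus sign
compared with `mul_prod_of_anticomm`. -/
theorem mul_listPartial_of_anticomm {f : ι → B} {z : B} {l : List ι}
    (h : ∀ x ∈ l, z * f x = -(f x * z)) :
    z * listPartial f l = -((-1) ^ l.length * (listPartial f l * z)) := by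
  induction l with
  | nil => simp [listPartial]
  | cons x l ih =>
    have hc : f x * (-1) ^ l.length = (-1) ^ l.length * f x :=
      ((Commute.neg_one_left (f x)).pow_left _).eq.symm
    have h' : ∀ y ∈ l, z * f y = -(f y * z) := fun y hy => h y (List.mem_cons_of_mem _ hy)
    rw [listPartial_cons, mul_sub, ← mul_assoc, h x List.mem_cons_self, neg_mul, mul_assoc (f x),
      ih h', mul_prod_of_anticomm h', List.length_cons, pow_succ, mul_neg, ← mul_assoc (f x), hc]
    noncomm_ring

/-- It allows a circuit relation to be checked on one convenient listing. Only vanishing is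
transported, so an integer factor is enough and its being a sign is not recorded. -/
theorem perm_sign {f : ι → B} {l l' : List ι} (hp : l.Perm l')
    (h : ∀ x ∈ l, ∀ y ∈ l, f x * f y = -(f y * f x)) :
    ∃ ε : ℤ, (l'.map f).prod = ε • (l.map f).prod ∧
      listPartial f l' = ε • listPartial f l := by
  induction hp with
  | nil => exact ⟨1, by simp, by simp⟩
  | cons x _ ih =>
    obtain ⟨ε, h₁, h₂⟩ := ih fun a ha b hb =>
      h a (List.mem_cons_of_mem _ ha) b (List.mem_cons_of_mem _ hb)
    refine ⟨ε, ?_, ?_⟩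
    · simp only [List.map_cons, List.prod_cons, h₁, mul_smul_comm]
    · simp only [listPartial_cons, h₁, h₂, smul_sub, mul_smul_comm]
  | swap x y l =>
    have hxy : f y * f x = -(f x * f y) := h y (by simp) x (by simp)
    refine ⟨-1, ?_, ?_⟩
    · simp [← mul_assoc, hxy]
    · simp only [listPartial_cons, List.map_cons, List.prod_cons, mul_sub, ← mul_assoc, hxy]
      noncomm_ring
  | trans hp₁ _ ih₁ ih₂ =>
    obtain ⟨ε, h₁, h₂⟩ := ih₁ h
    obtain ⟨δ, h₃, h₄⟩ := ih₂ fun a ha b hb => h a (hp₁.mem_iff.2 ha) b (hp₁.mem_iff.2 hb)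
    exact ⟨δ * ε, by rw [h₃, h₁, smul_smul], by rw [h₄, h₂, smul_smul]⟩

/-- Translating all the `f x` by a common `w` does not change `listPartial`. -/
theorem translate {f : ι → B} {w : B} (hw : w * w = 0) {l : List ι}
    (h : ∀ x ∈ l, w * f x = -(f x * w)) :
    (l.map fun x => f x + w).prod = (l.map f).prod + w * listPartial f l ∧
      listPartial (fun x => f x + w) l = listPartial f l := by
  -- The two claims are proved together: the product over the tail contributes `w` times its partial
  -- sum, which cancels against the `w` in the head factor.
  induction l with
  | nil => simp [listPartial]
  | cons x l ih =>
    obtain ⟨h₁, h₂⟩ := ih fun y hy => h y (List.mem_cons_of_mem _ hy)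
    have hx : f x * w = -(w * f x) := by rw [h x List.mem_cons_self, neg_neg]
    constructor
    · rw [List.map_cons, List.prod_cons, h₁, List.map_cons, List.prod_cons, listPartial_cons,
        add_mul, mul_add, mul_add, ← mul_assoc w w, hw, ← mul_assoc (f x) w, hx]
      noncomm_ring
    · rw [listPartial_cons, h₁, h₂, listPartial_cons, add_mul]
      abel

theorem listPartial_neg (f : ι → B) (l : List ι) :
    listPartial (fun x => -f x) l = -((-1) ^ l.length * listPartial f l) := by
  induction l with
  | nil => simp [listPartial]
  | cons x l ih =>
    have hc : f x * (-1) ^ l.length = (-1) ^ l.length * f x :=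
      ((Commute.neg_one_left (f x)).pow_left _).eq.symm
    have hp : ∀ l : List ι, (l.map fun x => -f x).prod = (-1) ^ l.length * (l.map f).prod := by
      intro l
      induction l with
      | nil => simp
      | cons x l ih =>
        have hc : f x * (-1) ^ l.length = (-1) ^ l.length * f x :=
          ((Commute.neg_one_left (f x)).pow_left _).eq.symm
        rw [List.map_cons, List.prod_cons, ih, List.map_cons, List.prod_cons, List.length_cons,
          pow_succ, neg_mul, ← mul_assoc, hc]
        noncomm_ring
    rw [listPartial_cons, ih, hp, listPartial_cons, List.length_cons, pow_succ, neg_mul_neg,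
      ← mul_assoc, hc]
    noncomm_ring

end ListPartial

/-! ### Orlik–Solomon families and operations on them -/

/-- A family of anticommuting elements of square zero that satisfies the relations of the
Orlik-Solomon algebra of `M`. -/
structure IsOSFamily {α : Type*} {B : Type*} [Ring B] (M : Matroid α) (f : α → B) : Prop where
  sq : ∀ x ∈ M.E, f x * f x = 0
  anticomm : ∀ x ∈ M.E, ∀ y ∈ M.E, f x * f y = -(f y * f x)
  rel : ∀ l : List α, l.Nodup → M.IsCircuit {x | x ∈ l} → listPartial f l = 0

namespace IsOSFamily

variable {α B B' : Type*} [Ring B] [Ring B'] {M : Matroid α} {f g : α → B}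

theorem congr (hf : IsOSFamily M f) (h : ∀ x ∈ M.E, f x = g x) : IsOSFamily M g where
  sq x hx := by rw [← h x hx, hf.sq x hx]
  anticomm x hx y hy := by rw [← h x hx, ← h y hy, hf.anticomm x hx y hy]
  rel l hl hC := by
    rw [← hf.rel l hl hC]
    exact (listPartial_congr fun x hx => h x (hC.subset_ground hx)).symm

theorem map (hf : IsOSFamily M f) (F : B →+* B') : IsOSFamily M fun x => F (f x) where
  sq x hx := by rw [← map_mul, hf.sq x hx, map_zero]
  anticomm x hx y hy := by rw [← map_mul, hf.anticomm x hx y hy, map_neg, map_mul]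
  rel l hl hC := by rw [← map_listPartial, hf.rel l hl hC, map_zero]

theorem of_map {F : B →+* B'} (hF : Function.Injective F)
    (hf : IsOSFamily M fun x => F (f x)) : IsOSFamily M f where
  sq x hx := hF (by rw [map_mul, hf.sq x hx, map_zero])
  anticomm x hx y hy := hF (by rw [map_mul, hf.anticomm x hx y hy, map_neg, map_mul])
  rel l hl hC := hF (by rw [map_listPartial, hf.rel l hl hC, map_zero])

theorem neg (hf : IsOSFamily M f) : IsOSFamily M fun x => -f x where
  sq x hx := by rw [neg_mul_neg, hf.sq x hx]
  anticomm x hx y hy := by rw [neg_mul_neg, neg_mul_neg, hf.anticomm x hx y hy]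
  rel l hl hC := by rw [listPartial_neg, hf.rel l hl hC, mul_zero, neg_zero]

/-- By `translate`, circuit relations do not see a common translation. The section of `A(φ)`, the
projective generators and the derivation all arise this way, for different `w`. -/
theorem add_const (hf : IsOSFamily M f) {w : B} (hw : w * w = 0)
    (h : ∀ x ∈ M.E, w * f x = -(f x * w)) : IsOSFamily M fun x => f x + w where
  sq x hx := by
    rw [add_mul, mul_add, mul_add, hf.sq x hx, h x hx, hw]
    abel
  anticomm x hx y hy := by
    rw [add_mul, mul_add, mul_add, add_mul, mul_add, mul_add, hf.anticomm x hx y hy, h x hx, h y hy,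
      hw]
    abel
  rel l hl hC := by
    rw [(translate hw fun x hx => h x (hC.subset_ground hx)).2, hf.rel l hl hC]

end IsOSFamily

end OrlikSolomon

namespace OrlikSolomon

/-! ### Universal property, graded commutativity and projective generators -/

section Lift

variable {𝕜 : Type v} [Field 𝕜] {α : Type u} {M : Matroid α}

section

variable {B : Type*} [Ring B] [Algebra 𝕜 B]

theorem linearCombination_anticomm {ι : Type*} {f : ι → B} (h : ∀ x y, f x * f y = -(f y * f x))
    (v w : ι →₀ 𝕜) :
    Finsupp.linearCombination 𝕜 f v * Finsupp.linearCombination 𝕜 f w =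
      -(Finsupp.linearCombination 𝕜 f w * Finsupp.linearCombination 𝕜 f v) := by
  induction v using Finsupp.induction_linear with
  | zero => simp
  | add v v' hv hv' => rw [map_add, add_mul, mul_add, hv, hv', neg_add]
  | single x a =>
    induction w using Finsupp.induction_linear with
    | zero => simp
    | add w w' hw hw' => rw [map_add, add_mul, mul_add, hw, hw', neg_add]
    | single y b =>
      simp only [Finsupp.linearCombination_single, smul_mul_assoc, mul_smul_comm, h x y, smul_neg]
      rw [smul_comm]

/-- The cross terms cancel by anticommutation. Vanishing of the squares is a separate hypothesis
because anticommutation does not give it in characteristic 2. -/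
theorem linearCombination_sq {ι : Type*} {f : ι → B} (hs : ∀ x, f x * f x = 0)
    (h : ∀ x y, f x * f y = -(f y * f x)) (v : ι →₀ 𝕜) :
    Finsupp.linearCombination 𝕜 f v * Finsupp.linearCombination 𝕜 f v = 0 := by
  induction v using Finsupp.induction_linear with
  | zero => simp
  | add v w hv hw =>
    rw [map_add, add_mul, mul_add, mul_add, hv, hw, linearCombination_anticomm h v w]
    abel
  | single x a => simp [hs]

/-- The map from the exterior algebra induced by an Orlik-Solomon family. -/
noncomputable def IsOSFamily.liftE {f : α → B} (hf : IsOSFamily M f) : E 𝕜 M →ₐ[𝕜] B :=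
  ExteriorAlgebra.lift 𝕜 ⟨Finsupp.linearCombination 𝕜 fun x : M.E => f x, fun v =>
    linearCombination_sq (fun x : M.E => hf.sq x x.2)
      (fun x y : M.E => hf.anticomm x x.2 y y.2) v⟩

theorem partialE_monomial_cons (x : M.E) (l : List M.E) :
    partialE 𝕜 M (monomial 𝕜 M (x :: l)) = monomial 𝕜 M l -
      ExteriorAlgebra.ι 𝕜 (Finsupp.single x (1 : 𝕜)) * partialE 𝕜 M (monomial 𝕜 M l) := by
  have h : partialE 𝕜 M (monomial 𝕜 M (x :: l)) =
      coordSum 𝕜 M (Finsupp.single x 1) • monomial 𝕜 M l -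
        ExteriorAlgebra.ι 𝕜 (Finsupp.single x (1 : 𝕜)) * partialE 𝕜 M (monomial 𝕜 M l) :=
    CliffordAlgebra.contractLeft_ι_mul (Q := (0 : QuadraticForm 𝕜 (V 𝕜 M))) _ _ _
  rw [h, coordSum, Finsupp.linearCombination_single, smul_eq_mul, mul_one, one_smul]

theorem map_monomial (F : E 𝕜 M →ₐ[𝕜] B) (l : List M.E) :
    F (monomial 𝕜 M l) =
      (l.map fun x => F (ExteriorAlgebra.ι 𝕜 (Finsupp.single x (1 : 𝕜)))).prod := by
  rw [monomial, map_list_prod, List.map_map]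
  rfl

/-- Contraction with the coordinate sum obeys the recursion that defines `listPartial`; this
translates the relations of `A 𝕜 M` into those of `IsOSFamily`. -/
theorem map_partialE_monomial (F : E 𝕜 M →ₐ[𝕜] B) (l : List M.E) :
    F (partialE 𝕜 M (monomial 𝕜 M l)) =
      listPartial (fun x => F (ExteriorAlgebra.ι 𝕜 (Finsupp.single x (1 : 𝕜)))) l := by
  induction l with
  | nil =>
    have : partialE 𝕜 M (monomial 𝕜 M []) = 0 :=
      CliffordAlgebra.contractLeft_one (Q := (0 : QuadraticForm 𝕜 (V 𝕜 M))) _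
    rw [this, map_zero]
    rfl
  | cons x l ih =>
    rw [partialE_monomial_cons, map_sub, map_mul, ih, map_monomial, listPartial_cons]

theorem IsOSFamily.liftE_single {f : α → B} (hf : IsOSFamily M f) (x : M.E) :
    hf.liftE (𝕜 := 𝕜) (ExteriorAlgebra.ι 𝕜 (Finsupp.single x (1 : 𝕜))) = f x := by
  rw [IsOSFamily.liftE, ExteriorAlgebra.lift_ι_apply, Finsupp.linearCombination_single, one_smul]

/-- The universal property of the Orlik-Solomon algebra. -/
noncomputable def IsOSFamily.lift {f : α → B} (hf : IsOSFamily M f) : A 𝕜 M →ₐ[𝕜] B :=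
  RingQuot.liftAlgHom 𝕜 ⟨hf.liftE, by
    rintro _ _ ⟨l, hl, hC⟩
    rw [map_partialE_monomial, map_zero]
    simp only [hf.liftE_single]
    rw [← listPartial_map f Subtype.val]
    refine hf.rel _ (hl.map Subtype.val_injective) ?_
    convert hC using 1
    ext a
    simp⟩

theorem IsOSFamily.lift_mk {f : α → B} (hf : IsOSFamily M f) (x : E 𝕜 M) :
    hf.lift (OrlikSolomon.mk 𝕜 M x) = hf.liftE x :=
  RingQuot.liftAlgHom_mkAlgHom_apply 𝕜 _ _ x

@[simp] theorem IsOSFamily.lift_gen {f : α → B} (hf : IsOSFamily M f) (x : M.E) :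
    hf.lift (gen 𝕜 M x) = f x := by
  rw [gen, hf.lift_mk, hf.liftE_single]

theorem IsOSFamily.lift_mem {f : α → B} (hf : IsOSFamily M f) (𝒜 : ℕ → Submodule 𝕜 B)
    [SetLike.GradedMonoid 𝒜] (h : ∀ x ∈ M.E, f x ∈ 𝒜 1) {n : ℕ} {a : A 𝕜 M}
    (ha : a ∈ grading 𝕜 M n) : hf.lift a ∈ 𝒜 n := by
  obtain ⟨x, hx, rfl⟩ := ha
  change hf.lift (OrlikSolomon.mk 𝕜 M x) ∈ 𝒜 n
  rw [hf.lift_mk]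
  have hx' : x ∈ ⋀[𝕜]^n (V 𝕜 M) := hx
  clear hx
  induction hx' using Submodule.pow_induction_on_left' with
  | algebraMap r =>
    rw [AlgHom.commutes, Algebra.algebraMap_eq_smul_one]
    exact Submodule.smul_mem _ _ SetLike.GradedOne.one_mem
  | add x y i hx hy ihx ihy =>
    rw [map_add]
    exact add_mem ihx ihy
  | mem_mul m hm i x hx ih =>
    obtain ⟨v, rfl⟩ := hm
    rw [map_mul, Nat.succ_eq_add_one, add_comm]
    refine SetLike.GradedMul.mul_mem ?_ ih
    rw [IsOSFamily.liftE, ExteriorAlgebra.lift_ι_apply, Finsupp.linearCombination_apply]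
    exact Submodule.sum_mem _ fun x _ => Submodule.smul_mem _ _ (h x x.2)

end

theorem mk_ι (v : V 𝕜 M) :
    mk 𝕜 M (ExteriorAlgebra.ι 𝕜 v) = Finsupp.linearCombination 𝕜 (gen 𝕜 M) v := by
  induction v using Finsupp.induction_linear with
  | zero => simp
  | add v w hv hw => rw [map_add, map_add, map_add, hv, hw]
  | single x a =>
    rw [Finsupp.linearCombination_single, gen, ← map_smul, ← map_smul, Finsupp.smul_single,
      smul_eq_mul, mul_one]

theorem adjoin_gen : Algebra.adjoin 𝕜 (Set.range (gen 𝕜 M)) = ⊤ := by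
  rw [eq_top_iff]
  rintro a -
  obtain ⟨x, rfl⟩ := RingQuot.mkAlgHom_surjective 𝕜 (Rel 𝕜 M) a
  change mk 𝕜 M x ∈ _
  induction x using ExteriorAlgebra.induction with
  | algebraMap r =>
    rw [AlgHom.commutes]
    exact Subalgebra.algebraMap_mem _ r
  | ι v =>
    rw [mk_ι, Finsupp.linearCombination_apply]
    exact Subalgebra.sum_mem _ fun x _ =>
      Subalgebra.smul_mem _ (Algebra.subset_adjoin (Set.mem_range_self x)) _
  | mul x y hx hy => rw [map_mul]; exact mul_mem hx hy
  | add x y hx hy => rw [map_add]; exact add_mem hx hy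

theorem induction_gen {p : A 𝕜 M → Prop} (algebraMap : ∀ r, p (algebraMap 𝕜 _ r))
    (gen : ∀ x, p (gen 𝕜 M x)) (add : ∀ a b, p a → p b → p (a + b))
    (mul : ∀ a b, p a → p b → p (a * b)) (a : A 𝕜 M) : p a := by
  have ha : a ∈ Algebra.adjoin 𝕜 (Set.range (OrlikSolomon.gen 𝕜 M)) := by
    rw [adjoin_gen]
    exact Algebra.mem_top
  induction ha using Algebra.adjoin_induction with
  | mem x hx =>
    obtain ⟨x, rfl⟩ := hx
    exact gen x
  | algebraMap r => exact algebraMap r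
  | add x y _ _ hx hy => exact add x y hx hy
  | mul x y _ _ hx hy => exact mul x y hx hy

theorem hom_ext_gen {B : Type*} [Semiring B] [Algebra 𝕜 B] {F G : A 𝕜 M →ₐ[𝕜] B}
    (h : ∀ x, F (gen 𝕜 M x) = G (gen 𝕜 M x)) : F = G :=
  AlgHom.ext_of_adjoin_eq_top adjoin_gen (by rintro _ ⟨x, rfl⟩; exact h x)

theorem gen_mem_grading (x : M.E) : gen 𝕜 M x ∈ grading 𝕜 M 1 :=
  mk_mem_grading 𝕜 M (ι_mem 𝕜 M _)

variable (𝕜 M) in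
open Classical in
/-- The generator `e_x`, extended by zero outside the ground set. -/
noncomputable def genOn (x : α) : A 𝕜 M := if h : x ∈ M.E then gen 𝕜 M ⟨x, h⟩ else 0

theorem genOn_of_mem {x : α} (h : x ∈ M.E) : genOn 𝕜 M x = gen 𝕜 M ⟨x, h⟩ := dif_pos h

@[simp] theorem genOn_coe (x : M.E) : genOn 𝕜 M x = gen 𝕜 M x := dif_pos x.2

theorem genOn_mem_grading (x : α) : genOn 𝕜 M x ∈ grading 𝕜 M 1 := by
  by_cases h : x ∈ M.E
  · rw [genOn_of_mem h]
    exact gen_mem_grading _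
  · rw [genOn, dif_neg h]
    exact zero_mem _

variable (𝕜 M) in
theorem isOSFamily_genOn : IsOSFamily M (genOn 𝕜 M) where
  sq x hx := by rw [genOn_of_mem hx, gen, ← map_mul (mk 𝕜 M), ExteriorAlgebra.ι_sq_zero, map_zero]
  anticomm x hx y hy := by
    rw [genOn_of_mem hx, genOn_of_mem hy, gen, gen, ← map_mul (mk 𝕜 M), ← map_mul (mk 𝕜 M),
      eq_neg_iff_add_eq_zero, ← map_add, ExteriorAlgebra.ι_add_mul_swap, map_zero]
  rel l hl hC := by
    have hr : l ∈ Set.range (List.map (Subtype.val : M.E → α)) := by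
      rw [Set.range_list_map]
      intro x hx
      exact ⟨⟨x, hC.subset_ground hx⟩, rfl⟩
    obtain ⟨l, rfl⟩ := hr
    rw [listPartial_map]
    simp only [genOn_coe, gen]
    rw [← map_partialE_monomial, ← map_zero (mk 𝕜 M)]
    refine RingQuot.mkAlgHom_rel 𝕜 (Rel.circuit l (List.Nodup.of_map _ hl) ?_)
    convert hC using 1
    ext a
    simp

theorem grading_induction {p : ℕ → A 𝕜 M → Prop}
    (algebraMap : ∀ r, p 0 (algebraMap 𝕜 _ r))
    (add : ∀ n a b, p n a → p n b → p n (a + b))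
    (mul : ∀ v n a, p n a → p (n + 1) (mk 𝕜 M (ExteriorAlgebra.ι 𝕜 v) * a))
    {n : ℕ} {a : A 𝕜 M} (ha : a ∈ grading 𝕜 M n) : p n a := by
  obtain ⟨x, hx, rfl⟩ := ha
  change p n (mk 𝕜 M x)
  have hx' : x ∈ ⋀[𝕜]^n (V 𝕜 M) := hx
  clear hx
  induction hx' using Submodule.pow_induction_on_left' with
  | algebraMap r => rw [AlgHom.commutes]; exact algebraMap r
  | add x y i hx hy ihx ihy => rw [map_add]; exact add _ _ _ ihx ihy
  | mem_mul m hm i x hx ih =>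
    obtain ⟨v, rfl⟩ := hm
    rw [map_mul]
    exact mul _ _ _ ih

/-- The Orlik-Solomon algebra is graded-commutative. -/
theorem mul_comm_of_mem_grading {m n : ℕ} {a b : A 𝕜 M} (ha : a ∈ grading 𝕜 M m)
    (hb : b ∈ grading 𝕜 M n) : a * b = (-1) ^ (n * m) * (b * a) := by
  -- The case where the left factor is a vector; the general case follows by peeling vectors off
  -- `a`.
  have hι : ∀ (v : V 𝕜 M) (n : ℕ) (b : A 𝕜 M), b ∈ grading 𝕜 M n →
      mk 𝕜 M (ExteriorAlgebra.ι 𝕜 v) * b = (-1) ^ n * (b * mk 𝕜 M (ExteriorAlgebra.ι 𝕜 v)) := by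
    intro v n b hb
    refine grading_induction (p := fun n b => mk 𝕜 M (ExteriorAlgebra.ι 𝕜 v) * b =
      (-1) ^ n * (b * mk 𝕜 M (ExteriorAlgebra.ι 𝕜 v))) ?_ ?_ ?_ hb
    · intro r
      rw [pow_zero, one_mul, Algebra.commutes]
    · intro n a b ha hb
      rw [mul_add, ha, hb, add_mul, mul_add]
    · intro w n b hb
      have hc : mk 𝕜 M (ExteriorAlgebra.ι 𝕜 w) * (-1) ^ n =
          (-1) ^ n * mk 𝕜 M (ExteriorAlgebra.ι 𝕜 w) :=
        ((Commute.neg_one_left _).pow_left _).eq.symm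
      have hs : mk 𝕜 M (ExteriorAlgebra.ι 𝕜 v) * mk 𝕜 M (ExteriorAlgebra.ι 𝕜 w) =
          -(mk 𝕜 M (ExteriorAlgebra.ι 𝕜 w) * mk 𝕜 M (ExteriorAlgebra.ι 𝕜 v)) := by
        rw [← map_mul (mk 𝕜 M), ← map_mul (mk 𝕜 M), eq_neg_iff_add_eq_zero, ← map_add,
          ExteriorAlgebra.ι_add_mul_swap, map_zero]
      rw [← mul_assoc, hs, neg_mul, mul_assoc, hb, ← mul_assoc _ ((-1) ^ n), hc, pow_succ]
      noncomm_ring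
  refine grading_induction (p := fun m a => a * b = (-1) ^ (n * m) * (b * a)) ?_ ?_ ?_ ha
  · intro r
    rw [mul_zero, pow_zero, one_mul, Algebra.commutes]
  · intro m a a' ha ha'
    rw [add_mul, ha, ha', mul_add, mul_add]
  · intro v m a ha
    have hc : mk 𝕜 M (ExteriorAlgebra.ι 𝕜 v) * (-1) ^ (n * m) =
        (-1) ^ (n * m) * mk 𝕜 M (ExteriorAlgebra.ι 𝕜 v) :=
      ((Commute.neg_one_left _).pow_left _).eq.symm
    rw [mul_assoc, ha, ← mul_assoc, hc, mul_assoc, ← mul_assoc _ b, hι v n b hb, mul_add, mul_one,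
      pow_add]
    simp only [mul_assoc]

variable (𝕜 M) in
/-- The automorphism of `A(M)` with `e_x ↦ -e_x`. -/
noncomputable def involute : A 𝕜 M →ₐ[𝕜] A 𝕜 M := (isOSFamily_genOn 𝕜 M).neg.lift

@[simp] theorem involute_gen (x : M.E) : involute 𝕜 M (gen 𝕜 M x) = -gen 𝕜 M x := by
  simp [involute]

/-- The involution records the parity sign, so `u` can be moved past an `a` that need not be
homogeneous. -/
theorem mul_eq_involute_mul {u : A 𝕜 M} (hu : ∀ x, u * gen 𝕜 M x = -(gen 𝕜 M x * u))
    (a : A 𝕜 M) : u * a = involute 𝕜 M a * u := by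
  induction a using induction_gen with
  | algebraMap r => rw [AlgHom.commutes, Algebra.commutes]
  | gen x => rw [hu, involute_gen, neg_mul]
  | add a b ha hb => rw [mul_add, ha, hb, map_add, add_mul]
  | mul a b ha hb => rw [← mul_assoc, ha, mul_assoc, hb, map_mul, mul_assoc]

/-- The projective Orlik-Solomon algebra is generated by the differences `e_x - e_i`, for any
fixed `i`. -/
theorem projective_eq_adjoin (i : M.E) :
    projective 𝕜 M = Algebra.adjoin 𝕜 (Set.range fun x => gen 𝕜 M x - gen 𝕜 M i) := by
  apply le_antisymm
  · refine Algebra.adjoin_le ?_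
    rintro _ ⟨v, hv, rfl⟩
    -- Replacing each `e_x` by `e_x - e_i` subtracts `(∑ v_x) e_i`, which is zero.
    have hs : mk 𝕜 M (ExteriorAlgebra.ι 𝕜 v) =
        Finsupp.linearCombination 𝕜 (fun x => gen 𝕜 M x - gen 𝕜 M i) v := by
      rw [coordSum, Finsupp.linearCombination_apply] at hv
      rw [mk_ι, Finsupp.linearCombination_apply, Finsupp.linearCombination_apply]
      simp only [smul_sub]
      rw [Finsupp.sum_sub, eq_comm, sub_eq_self]
      rw [Finsupp.sum, ← Finset.sum_smul]
      have : ∑ x ∈ v.support, v x = 0 := by simpa [Finsupp.sum] using hv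
      rw [this, zero_smul]
    rw [hs, Finsupp.linearCombination_apply]
    exact Subalgebra.sum_mem _ fun x _ =>
      Subalgebra.smul_mem _ (Algebra.subset_adjoin (Set.mem_range_self x)) _
  · refine Algebra.adjoin_le ?_
    rintro _ ⟨x, rfl⟩
    apply Algebra.subset_adjoin
    refine ⟨Finsupp.single x 1 - Finsupp.single i 1, ?_, ?_⟩
    · simp [coordSum]
    · rw [map_sub, map_sub]
      rfl

end Lift

end OrlikSolomon

/-! ### Circuits of the direct sum and of the parallel connection -/

section Circuits

variable {α : Type u} {M₁ M₂ : Matroid α}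

theorem Matroid.sum_isCircuit_inl {C : Set α} (hC : M₁.IsCircuit C) :
    (M₁.sum M₂).IsCircuit (Sum.inl '' C) := by
  rw [Matroid.isCircuit_iff_dep_forall_sdiff_singleton_indep]
  refine ⟨⟨?_, ?_⟩, ?_⟩
  · rw [Matroid.sum_indep_iff, Set.preimage_image_eq _ Sum.inl_injective]
    exact fun h => hC.not_indep h.1
  · rw [Matroid.sum_ground]
    exact (Set.image_mono hC.subset_ground).trans Set.subset_union_left
  · rintro _ ⟨x, hx, rfl⟩
    rw [← Set.image_singleton, ← Set.image_sdiff Sum.inl_injective, Matroid.sum_indep_iff,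
      Set.preimage_image_eq _ Sum.inl_injective, Set.preimage_inr_image_inl]
    exact ⟨hC.sdiff_singleton_indep hx, M₂.empty_indep⟩

theorem Matroid.sum_isCircuit_inr {C : Set α} (hC : M₂.IsCircuit C) :
    (M₁.sum M₂).IsCircuit (Sum.inr '' C) := by
  rw [Matroid.isCircuit_iff_dep_forall_sdiff_singleton_indep]
  refine ⟨⟨?_, ?_⟩, ?_⟩
  · rw [Matroid.sum_indep_iff, Set.preimage_image_eq _ Sum.inr_injective]
    exact fun h => hC.not_indep h.2
  · rw [Matroid.sum_ground]
    exact (Set.image_mono hC.subset_ground).trans Set.subset_union_right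
  · rintro _ ⟨x, hx, rfl⟩
    rw [← Set.image_singleton, ← Set.image_sdiff Sum.inr_injective, Matroid.sum_indep_iff,
      Set.preimage_image_eq _ Sum.inr_injective, Set.preimage_inl_image_inr]
    exact ⟨M₁.empty_indep, hC.sdiff_singleton_indep hx⟩

/-- A dependent set has a dependent trace on one summand, hence contains a circuit from there; by
minimality it equals that circuit. -/
theorem Matroid.IsCircuit.of_sum {C : Set (α ⊕ α)} (hC : (M₁.sum M₂).IsCircuit C) :
    (∃ D, M₁.IsCircuit D ∧ C = Sum.inl '' D) ∨ ∃ D, M₂.IsCircuit D ∧ C = Sum.inr '' D := by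
  have hg := hC.subset_ground
  rw [Matroid.sum_ground] at hg
  have h := hC.not_indep
  rw [Matroid.sum_indep_iff, not_and_or] at h
  rcases h with h | h
  · have hs : Sum.inl ⁻¹' C ⊆ M₁.E := fun x hx => by simpa using hg hx
    obtain ⟨D, hDC, hD⟩ := ((Matroid.not_indep_iff hs).1 h).exists_isCircuit_subset
    exact Or.inl ⟨D, hD, ((Matroid.sum_isCircuit_inl hD).eq_of_subset_isCircuit hC
      (Set.image_subset_iff.2 hDC)).symm⟩
  · have hs : Sum.inr ⁻¹' C ⊆ M₂.E := fun x hx => by simpa using hg hx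
    obtain ⟨D, hDC, hD⟩ := ((Matroid.not_indep_iff hs).1 h).exists_isCircuit_subset
    exact Or.inr ⟨D, hD, ((Matroid.sum_isCircuit_inr hD).eq_of_subset_isCircuit hC
      (Set.image_subset_iff.2 hDC)).symm⟩

namespace ParallelConnection

theorem eq_of_mem_of_mem {i : α} (hE : M₁.E ∩ M₂.E = {i}) {x : α} (hx₁ : x ∈ M₁.E) (hx₂ : x ∈ M₂.E) :
    x = i := by
  have : x ∈ M₁.E ∩ M₂.E := ⟨hx₁, hx₂⟩
  rwa [hE] at this

variable [M₁.Finite] [M₂.Finite] {i : α}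
  (hE : M₁.E ∩ M₂.E = {i}) (h₁ : M₁.IsNonloop i) (h₂ : M₂.IsNonloop i)

theorem parallelConnection_indep_iff {I : Set α} :
    (parallelConnection M₁ M₂ i hE h₁ h₂).Indep I ↔ Indep M₁ M₂ i I := Iff.rfl

/-- After deletion of `x`, the trace on `M₁` is independent. Even with `i` added, the trace on `M₂`
lies in `{i}`, which is independent because `i` is not a loop. -/
theorem isCircuit_left {C : Set α} (hC : M₁.IsCircuit C) :
    (parallelConnection M₁ M₂ i hE h₁ h₂).IsCircuit C := by
  rw [Matroid.isCircuit_iff_dep_forall_sdiff_singleton_indep]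
  refine ⟨⟨fun h => h.2 C (Or.inl hC) subset_rfl, hC.subset_ground.trans Set.subset_union_left⟩,
    fun x hx => ?_⟩
  rw [parallelConnection_indep_iff, indep_iff h₁ h₂]
  refine ⟨Set.sdiff_subset.trans (hC.subset_ground.trans Set.subset_union_left), Or.inl
    ⟨(hC.sdiff_singleton_indep hx).subset Set.inter_subset_left, h₂.indep.subset ?_⟩⟩
  rintro y ⟨rfl | hy, hy₂⟩
  · rfl
  · exact eq_of_mem_of_mem hE (hC.subset_ground hy.1) hy₂

theorem isCircuit_right {C : Set α} (hC : M₂.IsCircuit C) :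
    (parallelConnection M₁ M₂ i hE h₁ h₂).IsCircuit C := by
  rw [Matroid.isCircuit_iff_dep_forall_sdiff_singleton_indep]
  refine ⟨⟨fun h => h.2 C (Or.inr (Or.inl hC)) subset_rfl,
    hC.subset_ground.trans Set.subset_union_right⟩, fun x hx => ?_⟩
  rw [parallelConnection_indep_iff, indep_iff h₁ h₂]
  refine ⟨Set.sdiff_subset.trans (hC.subset_ground.trans Set.subset_union_right), Or.inr
    ⟨h₁.indep.subset ?_, (hC.sdiff_singleton_indep hx).subset Set.inter_subset_left⟩⟩
  rintro y ⟨rfl | hy, hy₁⟩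
  · rfl
  · exact eq_of_mem_of_mem hE hy₁ (hC.subset_ground hy.1)

/-- A dependent set contains a listed set, and each listed set is dependent, so minimality forces
equality. The converse is needed only for circuits of `M₁` and `M₂`, since the mixed relations will
be deduced. -/
theorem mem_circuits_of_isCircuit {C : Set α}
    (hC : (parallelConnection M₁ M₂ i hE h₁ h₂).IsCircuit C) : C ∈ circuits M₁ M₂ i := by
  have hd : ¬ Indep M₁ M₂ i C := hC.not_indep
  have hg : C ⊆ M₁.E ∪ M₂.E := hC.subset_ground
  simp only [Indep, hg, true_and, not_forall, not_not] at hd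
  obtain ⟨D, hD, hDC⟩ := hd
  have hdep : (parallelConnection M₁ M₂ i hE h₁ h₂).Dep D :=
    ⟨fun h => h.2 D hD subset_rfl, hDC.trans hg⟩
  rwa [(Matroid.isCircuit_iff.1 hC).2 hdep hDC] at hD

end ParallelConnection

end Circuits

/-! ### Families for the direct sum and the parallel connection -/

namespace OrlikSolomon

variable {α : Type u} {M₁ M₂ : Matroid α} {B : Type*} [Ring B]

theorem isOSFamily_sum_iff {f : α ⊕ α → B} :
    IsOSFamily (M₁.sum M₂) f ↔ IsOSFamily M₁ (fun x => f (Sum.inl x)) ∧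
      IsOSFamily M₂ (fun x => f (Sum.inr x)) ∧
      ∀ x ∈ M₁.E, ∀ y ∈ M₂.E, f (Sum.inl x) * f (Sum.inr y) = -(f (Sum.inr y) * f (Sum.inl x)) := by
  have g₁ : ∀ x ∈ M₁.E, Sum.inl x ∈ (M₁.sum M₂).E := fun x hx => by simpa using hx
  have g₂ : ∀ x ∈ M₂.E, Sum.inr x ∈ (M₁.sum M₂).E := fun x hx => by simpa using hx
  constructor
  · intro h
    refine ⟨⟨fun x hx => h.sq _ (g₁ x hx), fun x hx y hy => h.anticomm _ (g₁ x hx) _ (g₁ y hy),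
      fun l hl hC => ?_⟩, ⟨fun x hx => h.sq _ (g₂ x hx),
      fun x hx y hy => h.anticomm _ (g₂ x hx) _ (g₂ y hy), fun l hl hC => ?_⟩,
      fun x hx y hy => h.anticomm _ (g₁ x hx) _ (g₂ y hy)⟩
    · rw [← listPartial_map f Sum.inl]
      refine h.rel _ (hl.map Sum.inl_injective) ?_
      convert Matroid.sum_isCircuit_inl hC using 1
      ext x
      simp
    · rw [← listPartial_map f Sum.inr]
      refine h.rel _ (hl.map Sum.inr_injective) ?_
      convert Matroid.sum_isCircuit_inr hC using 1
      ext x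
      simp
  · rintro ⟨hf₁, hf₂, hc⟩
    refine ⟨?_, ?_, ?_⟩
    · rintro (x | x) hx
      · exact hf₁.sq x (by simpa using hx)
      · exact hf₂.sq x (by simpa using hx)
    · rintro (x | x) hx (y | y) hy
      · exact hf₁.anticomm x (by simpa using hx) y (by simpa using hy)
      · exact hc x (by simpa using hx) y (by simpa using hy)
      · rw [hc y (by simpa using hy) x (by simpa using hx), neg_neg]
      · exact hf₂.anticomm x (by simpa using hx) y (by simpa using hy)
    · intro l hl hC
      rcases hC.of_sum with ⟨D, hD, h⟩ | ⟨D, hD, h⟩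
      · have hr : l ∈ Set.range (List.map (Sum.inl : α → α ⊕ α)) := by
          rw [Set.range_list_map]
          intro x hx
          have : x ∈ Sum.inl '' D := h ▸ hx
          exact Set.image_subset_range _ _ this
        obtain ⟨l, rfl⟩ := hr
        rw [listPartial_map]
        refine hf₁.rel l (List.Nodup.of_map _ hl) ?_
        convert hD using 1
        rw [← Set.preimage_image_eq D (Sum.inl_injective (β := α)), ← h]
        ext x
        simp
      · have hr : l ∈ Set.range (List.map (Sum.inr : α → α ⊕ α)) := by
          rw [Set.range_list_map]
          intro x hx
          have : x ∈ Sum.inr '' D := h ▸ hx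
          exact Set.image_subset_range _ _ this
        obtain ⟨l, rfl⟩ := hr
        rw [listPartial_map]
        refine hf₂.rel l (List.Nodup.of_map _ hl) ?_
        convert hD using 1
        rw [← Set.preimage_image_eq D (Sum.inr_injective (α := α)), ← h]
        ext x
        simp

section

variable [M₁.Finite] [M₂.Finite] {i : α}
  (hE : M₁.E ∩ M₂.E = {i}) (h₁ : M₁.IsNonloop i) (h₂ : M₂.IsNonloop i)

/-- If `f` satisfies the relations of two lists that share their first element, it satisfies
that of the list obtained by gluing them and deleting the first element. -/
theorem listPartial_append_eq_zero {f : α → B} {A A' : List α} {i : α}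
    (hA : listPartial f (i :: A) = 0) (hA' : listPartial f (i :: A') = 0)
    (h : ∀ x ∈ A, f i * f x = -(f x * f i)) : listPartial f (A ++ A') = 0 := by
  -- The hypotheses now say that each product equals `f i` times its partial sum. Both Leibniz terms
  -- become multiples of `∂A * f i * ∂A'`, with opposite signs once `f i` is moved past `∂A`.
  rw [listPartial_cons, sub_eq_zero] at hA hA'
  have hs : (-1 : B) ^ A.length * (-1) ^ A.length = 1 := by
    rw [← pow_add, Even.neg_one_pow ⟨_, rfl⟩]
  rw [listPartial_append, hA, hA', mul_listPartial_of_anticomm h, neg_mul, mul_neg, mul_assoc,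
    ← mul_assoc ((-1) ^ A.length), hs, one_mul, mul_assoc,
    add_neg_cancel]

/-- The only relations not inherited from `M₁` or `M₂` belong to mixed circuits, and
`listPartial_append_eq_zero` derives them from the two circuits through `i`. -/
theorem isOSFamily_parallelConnection_iff {f : α → B} :
    IsOSFamily (parallelConnection M₁ M₂ i hE h₁ h₂) f ↔ IsOSFamily M₁ f ∧ IsOSFamily M₂ f ∧
      ∀ x ∈ M₁.E, ∀ y ∈ M₂.E, f x * f y = -(f y * f x) := by
  constructor
  · intro h
    exact ⟨⟨fun x hx => h.sq x (Or.inl hx), fun x hx y hy => h.anticomm x (Or.inl hx) y (Or.inl hy),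
      fun l hl hC => h.rel l hl (ParallelConnection.isCircuit_left hE h₁ h₂ hC)⟩,
      ⟨fun x hx => h.sq x (Or.inr hx), fun x hx y hy => h.anticomm x (Or.inr hx) y (Or.inr hy),
      fun l hl hC => h.rel l hl (ParallelConnection.isCircuit_right hE h₁ h₂ hC)⟩,
      fun x hx y hy => h.anticomm x (Or.inl hx) y (Or.inr hy)⟩
  · rintro ⟨hf₁, hf₂, hc⟩
    have ha : ∀ x ∈ M₁.E ∪ M₂.E, ∀ y ∈ M₁.E ∪ M₂.E, f x * f y = -(f y * f x) := by
      rintro x (hx | hx) y (hy | hy)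
      · exact hf₁.anticomm x hx y hy
      · exact hc x hx y hy
      · rw [hc y hy x hx, neg_neg]
      · exact hf₂.anticomm x hx y hy
    refine ⟨?_, ha, ?_⟩
    · rintro x (hx | hx)
      · exact hf₁.sq x hx
      · exact hf₂.sq x hx
    · intro l hl hC
      rcases ParallelConnection.mem_circuits_of_isCircuit hE h₁ h₂ hC with
        h | h | ⟨C₁, C₂, hC₁, hC₂, hi₁, hi₂, h⟩
      · exact hf₁.rel l hl h
      · exact hf₂.rel l hl h
      · classical
        have hmem : ∀ x, x ∈ l ↔ (x ∈ C₁ ∧ x ≠ i) ∨ (x ∈ C₂ ∧ x ≠ i) := fun x =>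
          Set.ext_iff.1 h x
        have hdisj : ∀ x, x ∈ C₂ → x ∈ C₁ → x = i := fun x hx hx' =>
          ParallelConnection.eq_of_mem_of_mem hE (hC₁.subset_ground hx') (hC₂.subset_ground hx)
        have hil : i ∉ l := fun hi => by simpa using (hmem i).1 hi
        -- The listing is sorted into its `C₁` part followed by its `C₂` part. The two parts are
        -- disjoint because `i`, the only possible common element, has been removed.
        set A := l.filter fun x => decide (x ∈ C₁) with hA
        set A' := l.filter fun x => !decide (x ∈ C₁) with hA'
        have hp : (A ++ A').Perm l := List.filter_append_perm _ l
        have hAm : ∀ x, x ∈ A ↔ x ∈ C₁ ∧ x ≠ i := fun x => by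
          simp only [hA, List.mem_filter, hmem, decide_eq_true_eq]
          have := hdisj x
          tauto
        have hAm' : ∀ x, x ∈ A' ↔ x ∈ C₂ ∧ x ≠ i := fun x => by
          simp only [hA', List.mem_filter, hmem, Bool.not_eq_true', decide_eq_false_iff_not]
          have := hdisj x
          tauto
        have r₁ : listPartial f (i :: A) = 0 := by
          refine hf₁.rel _ (List.nodup_cons.2 ⟨fun hi => ((hAm i).1 hi).2 rfl, hl.filter _⟩) ?_
          convert hC₁ using 1
          ext x
          simp only [List.mem_cons, hAm, Set.mem_ofPred_eq]
          by_cases hx : x = i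
          · simp [hx, hi₁]
          · simp [hx]
        have r₂ : listPartial f (i :: A') = 0 := by
          refine hf₂.rel _ (List.nodup_cons.2 ⟨fun hi => ((hAm' i).1 hi).2 rfl, hl.filter _⟩) ?_
          convert hC₂ using 1
          ext x
          simp only [List.mem_cons, hAm', Set.mem_ofPred_eq]
          by_cases hx : x = i
          · simp [hx, hi₂]
          · simp [hx]
        have hz := listPartial_append_eq_zero r₁ r₂ fun x hx =>
          hf₁.anticomm i h₁.mem_ground x (hC₁.subset_ground ((hAm x).1 hx).1)
        obtain ⟨ε, -, hε⟩ := perm_sign (f := f) hp fun x hx y hy =>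
          ha x (hC.subset_ground (hp.mem_iff.1 hx)) y (hC.subset_ground (hp.mem_iff.1 hy))
        rw [hε, hz, smul_zero]

end

end OrlikSolomon

/-! ### Multiplication by `e_i - e_{i'}` and its exactness -/

namespace OrlikSolomon

variable (𝕜 : Type v) [Field 𝕜] {α : Type u} (M₁ M₂ : Matroid α)

/-- The difference of the two elements `e_i` and `e_{i'}` of the algebra of the direct sum. -/
noncomputable def genDiff (i : α) : A 𝕜 (M₁.sum M₂) :=
  genOn 𝕜 (M₁.sum M₂) (Sum.inl i) - genOn 𝕜 (M₁.sum M₂) (Sum.inr i)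

variable {M₁ M₂} {i : α}

theorem inl_mem_sum {x : α} (h : x ∈ M₁.E) : Sum.inl x ∈ (M₁.sum M₂).E := by simpa using h

theorem inr_mem_sum {x : α} (h : x ∈ M₂.E) : Sum.inr x ∈ (M₁.sum M₂).E := by simpa using h

theorem genDiff_sq (h₁ : i ∈ M₁.E) (h₂ : i ∈ M₂.E) :
    genDiff 𝕜 M₁ M₂ i * genDiff 𝕜 M₁ M₂ i = 0 := by
  have h := isOSFamily_genOn 𝕜 (M₁.sum M₂)
  rw [genDiff, sub_mul, mul_sub, mul_sub, h.sq _ (inl_mem_sum h₁), h.sq _ (inr_mem_sum h₂),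
    h.anticomm _ (inl_mem_sum h₁) _ (inr_mem_sum h₂)]
  abel

theorem genDiff_anticomm (h₁ : i ∈ M₁.E) (h₂ : i ∈ M₂.E) {x : α ⊕ α} (hx : x ∈ (M₁.sum M₂).E) :
    genDiff 𝕜 M₁ M₂ i * genOn 𝕜 (M₁.sum M₂) x =
      -(genOn 𝕜 (M₁.sum M₂) x * genDiff 𝕜 M₁ M₂ i) := by
  have h := isOSFamily_genOn 𝕜 (M₁.sum M₂)
  rw [genDiff, sub_mul, mul_sub, h.anticomm _ (inl_mem_sum h₁) _ hx,
    h.anticomm _ (inr_mem_sum h₂) _ hx]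
  abel

section Derivation

variable (M : Matroid α)

/-- The homomorphism `a ↦ diag(a, â)`, where `â` is the image of `a` under `e_x ↦ -e_x`. -/
noncomputable def diagInvolute : A 𝕜 M →ₐ[𝕜] Matrix (Fin 2) (Fin 2) (A 𝕜 M) :=
  (Matrix.diagonalAlgHom 𝕜).comp (AlgHom.pi ![AlgHom.id 𝕜 _, involute 𝕜 M])

variable {M}

theorem diagInvolute_genOn {x : α} (hx : x ∈ M.E) :
    diagInvolute 𝕜 M (genOn 𝕜 M x) = !![genOn 𝕜 M x, 0; 0, -genOn 𝕜 M x] := by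
  rw [genOn_of_mem hx]
  ext a b
  fin_cases a <;> fin_cases b <;> simp [diagInvolute]

variable (M₁ M₂)

/-- The family `e_x ↦ diag(e_x, -e_x)`, modified in the lower left corner for `x` in `M₁`; its
lift has in that corner the derivation with `e_x ↦ 1` for `x` in `M₁` and `e_x ↦ 0` for `x`
in `M₂`. -/
noncomputable def matrixFamily (x : α ⊕ α) : Matrix (Fin 2) (Fin 2) (A 𝕜 (M₁.sum M₂)) :=
  diagInvolute 𝕜 _ (genOn 𝕜 (M₁.sum M₂) x) + Sum.elim (fun _ => !![0, 0; 1, 0]) (fun _ => 0) x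

/-- The corner matrix squares to zero and anticommutes with every `diag(e_x, -e_x)`, so the `M₁`
half may be translated by it; the relations across the two halves survive for the same reason. -/
theorem isOSFamily_matrixFamily : IsOSFamily (M₁.sum M₂) (matrixFamily 𝕜 M₁ M₂) := by
  have h := (isOSFamily_genOn 𝕜 (M₁.sum M₂)).map (diagInvolute 𝕜 (M₁.sum M₂)).toRingHom
  have hw : ∀ x ∈ (M₁.sum M₂).E,
      !![0, 0; 1, 0] * diagInvolute 𝕜 _ (genOn 𝕜 (M₁.sum M₂) x) =
        -(diagInvolute 𝕜 _ (genOn 𝕜 (M₁.sum M₂) x) * !![0, 0; 1, 0]) := by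
    intro x hx
    rw [diagInvolute_genOn 𝕜 hx]
    ext a b
    fin_cases a <;> fin_cases b <;> simp
  have h' := isOSFamily_sum_iff.1 h
  refine isOSFamily_sum_iff.2 ⟨?_, ?_, ?_⟩
  · refine h'.1.add_const (w := !![0, 0; 1, 0]) ?_ fun x hx => hw _ (inl_mem_sum hx)
    ext a b
    fin_cases a <;> fin_cases b <;> simp
  · exact h'.2.1.congr fun x _ => (add_zero _).symm
  · intro x hx y hy
    have hxy := h'.2.2 x hx y hy
    simp only [AlgHom.toRingHom_eq_coe, RingHom.coe_coe] at hxy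
    simp only [matrixFamily, Sum.elim_inl, Sum.elim_inr, add_zero]
    rw [add_mul, mul_add, hxy, hw _ (inr_mem_sum hy), neg_add]

/-- The upper right entry is included so that the upper left one is multiplicative. -/
theorem matrixFamily_lift (a : A 𝕜 (M₁.sum M₂)) :
    (isOSFamily_matrixFamily 𝕜 M₁ M₂).lift (𝕜 := 𝕜) a 0 0 = a ∧
      (isOSFamily_matrixFamily 𝕜 M₁ M₂).lift (𝕜 := 𝕜) a 0 1 = 0 := by
  induction a using induction_gen with
  | algebraMap r => simp [Matrix.algebraMap_matrix_apply]
  | gen x =>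
    rw [IsOSFamily.lift_gen, matrixFamily, diagInvolute_genOn 𝕜 x.2]
    obtain ⟨x | x, hx⟩ := x <;> simp [genOn_of_mem hx]
  | add a b ha hb => simp [ha, hb]
  | mul a b ha hb => simp [Matrix.mul_apply, ha, hb]

end Derivation

/-- Multiplication by `e_i - e_{i'}` is exact. -/
theorem exists_eq_genDiff_mul (h₁ : i ∈ M₁.E) (h₂ : i ∈ M₂.E) {a : A 𝕜 (M₁.sum M₂)}
    (ha : genDiff 𝕜 M₁ M₂ i * a = 0) : ∃ b, a = genDiff 𝕜 M₁ M₂ i * b := by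
  set T := (isOSFamily_matrixFamily 𝕜 M₁ M₂).lift (𝕜 := 𝕜)
  -- The corner entry is `1 - 0`: only the copy of `i` in `M₁` contributes.
  have hT : T (genDiff 𝕜 M₁ M₂ i) =
      !![genDiff 𝕜 M₁ M₂ i, 0; 1, -genDiff 𝕜 M₁ M₂ i] := by
    rw [genDiff, map_sub, genOn_of_mem (inl_mem_sum h₁), genOn_of_mem (inr_mem_sum h₂),
      IsOSFamily.lift_gen, IsOSFamily.lift_gen, matrixFamily, matrixFamily,
      diagInvolute_genOn 𝕜 (inl_mem_sum h₁), diagInvolute_genOn 𝕜 (inr_mem_sum h₂),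
      genOn_of_mem (inl_mem_sum h₁), genOn_of_mem (inr_mem_sum h₂)]
    ext a b
    fin_cases a <;> fin_cases b <;> simp
    abel
  -- The lower left entry of `T u * T a = 0` reads `a - u * D a = 0`, where `D a` is `T a 1 0`.
  have h := congrArg (fun m => m 1 0) (congrArg T ha)
  simp only [map_mul, map_zero, hT, Matrix.mul_apply, Fin.sum_univ_two, Matrix.zero_apply] at h
  rw [(matrixFamily_lift 𝕜 M₁ M₂ a).1] at h
  refine ⟨T a 1 0, ?_⟩
  simpa [← sub_eq_add_neg, sub_eq_zero] using h

/-! ### The map `A(φ)` and its section -/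

section ExactSequence

open Classical in
/-- The images of the generators under a section of `A(φ)`. -/
noncomputable def sectionFamily (M₁ M₂ : Matroid α) (i x : α) : A 𝕜 (M₁.sum M₂) :=
  if x ∈ M₁.E then genOn 𝕜 (M₁.sum M₂) (Sum.inl x)
  else genOn 𝕜 (M₁.sum M₂) (Sum.inr x) + genDiff 𝕜 M₁ M₂ i

/-- The two prescriptions agree at `i`, since `e_{i'} + (e_i - e_{i'}) = e_i`; this dictates the
choice of translation. -/
theorem sectionFamily_right (hE : M₁.E ∩ M₂.E = {i}) {x : α} (hx : x ∈ M₂.E) :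
    sectionFamily 𝕜 M₁ M₂ i x = genOn 𝕜 (M₁.sum M₂) (Sum.inr x) + genDiff 𝕜 M₁ M₂ i := by
  by_cases h : x ∈ M₁.E
  · rw [sectionFamily, if_pos h, ParallelConnection.eq_of_mem_of_mem hE h hx, genDiff]
    abel
  · rw [sectionFamily, if_neg h]

variable [M₁.Finite] [M₂.Finite]
  (hE : M₁.E ∩ M₂.E = {i}) (h₁ : M₁.IsNonloop i) (h₂ : M₂.IsNonloop i)

theorem isOSFamily_identify :
    IsOSFamily (M₁.sum M₂)
      (Sum.elim (genOn 𝕜 (parallelConnection M₁ M₂ i hE h₁ h₂))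
        (genOn 𝕜 (parallelConnection M₁ M₂ i hE h₁ h₂))) :=
  isOSFamily_sum_iff.2 ((isOSFamily_parallelConnection_iff hE h₁ h₂).1 (isOSFamily_genOn 𝕜 _))

/-- The homomorphism `A(φ)` from the algebra of the direct sum to that of the parallel
connection. -/
noncomputable def mapIdentify :
    A 𝕜 (M₁.sum M₂) →ₐ[𝕜] A 𝕜 (parallelConnection M₁ M₂ i hE h₁ h₂) :=
  (isOSFamily_identify 𝕜 hE h₁ h₂).lift

theorem isOSFamily_sectionFamily :
    IsOSFamily (parallelConnection M₁ M₂ i hE h₁ h₂) (sectionFamily 𝕜 M₁ M₂ i) := by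
  have h := isOSFamily_sum_iff.1 (isOSFamily_genOn 𝕜 (M₁.sum M₂))
  have e₁ := h₁.mem_ground
  have e₂ := h₂.mem_ground
  refine (isOSFamily_parallelConnection_iff hE h₁ h₂).2 ⟨?_, ?_, ?_⟩
  · exact h.1.congr fun x hx => (if_pos hx).symm
  · exact (h.2.1.add_const (genDiff_sq 𝕜 e₁ e₂)
      fun x hx => genDiff_anticomm 𝕜 e₁ e₂ (inr_mem_sum hx)).congr
      fun x hx => (sectionFamily_right 𝕜 hE hx).symm
  · intro x hx y hy
    rw [sectionFamily_right 𝕜 hE hy, sectionFamily, if_pos hx, mul_add, add_mul,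
      h.2.2 x hx y hy, genDiff_anticomm 𝕜 e₁ e₂ (inl_mem_sum hx), neg_add, neg_neg]

/-- A section of `A(φ)`. -/
noncomputable def sectionHom :
    A 𝕜 (parallelConnection M₁ M₂ i hE h₁ h₂) →ₐ[𝕜] A 𝕜 (M₁.sum M₂) :=
  (isOSFamily_sectionFamily 𝕜 hE h₁ h₂).lift

theorem mapIdentify_genOn_inl {x : α} (hx : x ∈ M₁.E) :
    mapIdentify 𝕜 hE h₁ h₂ (genOn 𝕜 _ (Sum.inl x)) = genOn 𝕜 _ x := by
  rw [genOn_of_mem (inl_mem_sum hx), mapIdentify, IsOSFamily.lift_gen]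
  rfl

theorem mapIdentify_genOn_inr {x : α} (hx : x ∈ M₂.E) :
    mapIdentify 𝕜 hE h₁ h₂ (genOn 𝕜 _ (Sum.inr x)) = genOn 𝕜 _ x := by
  rw [genOn_of_mem (inr_mem_sum hx), mapIdentify, IsOSFamily.lift_gen]
  rfl

theorem mapIdentify_genDiff : mapIdentify 𝕜 hE h₁ h₂ (genDiff 𝕜 M₁ M₂ i) = 0 := by
  rw [genDiff, map_sub, mapIdentify_genOn_inl _ _ _ _ h₁.mem_ground,
    mapIdentify_genOn_inr _ _ _ _ h₂.mem_ground, sub_self]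

theorem mapIdentify_sectionHom (b : A 𝕜 (parallelConnection M₁ M₂ i hE h₁ h₂)) :
    mapIdentify 𝕜 hE h₁ h₂ (sectionHom 𝕜 hE h₁ h₂ b) = b := by
  suffices h : (mapIdentify 𝕜 hE h₁ h₂).comp (sectionHom 𝕜 hE h₁ h₂) = AlgHom.id 𝕜 _ from
    DFunLike.congr_fun h b
  refine hom_ext_gen fun x => ?_
  rw [AlgHom.comp_apply, sectionHom, IsOSFamily.lift_gen, AlgHom.id_apply, ← genOn_coe]
  obtain ⟨x, hx | hx⟩ := x
  · rw [sectionFamily, if_pos hx, mapIdentify_genOn_inl _ _ _ _ hx]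
  · rw [sectionFamily_right 𝕜 hE hx, map_add, mapIdentify_genOn_inr _ _ _ _ hx,
      mapIdentify_genDiff, add_zero]

/-- The section after `A(φ)` moves generators only by multiples of `u = e_i - e_{i'}`, and `u * u =
0`. This is the formula for `j`, and it shows that `u` annihilates the kernel of `A(φ)`. -/
theorem genDiff_mul_sectionHom (a : A 𝕜 (M₁.sum M₂)) :
    genDiff 𝕜 M₁ M₂ i * sectionHom 𝕜 hE h₁ h₂ (mapIdentify 𝕜 hE h₁ h₂ a) =
      genDiff 𝕜 M₁ M₂ i * a := by
  have hu : ∀ x, genDiff 𝕜 M₁ M₂ i * gen 𝕜 (M₁.sum M₂) x =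
      -(gen 𝕜 (M₁.sum M₂) x * genDiff 𝕜 M₁ M₂ i) := fun x => by
    rw [← genOn_coe, genDiff_anticomm 𝕜 h₁.mem_ground h₂.mem_ground x.2]
  induction a using induction_gen with
  | algebraMap r => rw [AlgHom.commutes, AlgHom.commutes]
  | gen x =>
    rw [← genOn_coe]
    obtain ⟨x | x, hx⟩ := x
    · have hx' : x ∈ M₁.E := by simpa using hx
      rw [mapIdentify_genOn_inl _ _ _ _ hx', genOn_of_mem (Or.inl hx'), sectionHom,
        IsOSFamily.lift_gen, sectionFamily, if_pos hx']
    · have hx' : x ∈ M₂.E := by simpa using hx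
      rw [mapIdentify_genOn_inr _ _ _ _ hx', genOn_of_mem (Or.inr hx'), sectionHom,
        IsOSFamily.lift_gen, sectionFamily_right 𝕜 hE hx', mul_add,
        genDiff_sq 𝕜 h₁.mem_ground h₂.mem_ground, add_zero]
  | add a b ha hb => rw [map_add, map_add, mul_add, ha, hb, mul_add]
  | mul a b ha hb =>
    -- The factor `u` is carried past `a` to reach the second factor, then carried back.
    rw [map_mul, map_mul, ← mul_assoc, ha, mul_eq_involute_mul hu, mul_assoc, hb, ← mul_assoc,
      ← mul_eq_involute_mul hu, mul_assoc]

end ExactSequence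

end OrlikSolomon

namespace OrlikSolomon

/-! ### The generators `e_x - e_i` of the projective algebra -/

section Projective

variable (𝕜 : Type v) [Field 𝕜] {α : Type u} {M : Matroid α} {i : α}

theorem genOn_sub_mem_projective (hi : i ∈ M.E) {x : α} (hx : x ∈ M.E) :
    genOn 𝕜 M x - genOn 𝕜 M i ∈ projective 𝕜 M := by
  rw [projective_eq_adjoin ⟨i, hi⟩, genOn_of_mem hi, genOn_of_mem hx]
  exact Algebra.subset_adjoin (Set.mem_range_self (⟨x, hx⟩ : M.E))

open Classical in
/-- The element `e_x - e_i` of the projective algebra. -/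
noncomputable def projGen (M : Matroid α) (i x : α) : projective 𝕜 M :=
  if h : x ∈ M.E ∧ i ∈ M.E then ⟨_, genOn_sub_mem_projective 𝕜 h.2 h.1⟩ else 0

theorem coe_projGen (hi : i ∈ M.E) {x : α} (hx : x ∈ M.E) :
    (projGen 𝕜 M i x : A 𝕜 M) = genOn 𝕜 M x - genOn 𝕜 M i := by
  rw [projGen, dif_pos ⟨hx, hi⟩]

theorem projGen_self (hi : i ∈ M.E) : projGen 𝕜 M i i = 0 :=
  Subtype.ext (by rw [coe_projGen 𝕜 hi hi, sub_self]; rfl)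

theorem projGen_mem_projGrading (x : α) : projGen 𝕜 M i x ∈ projGrading 𝕜 M 1 := by
  by_cases h : x ∈ M.E ∧ i ∈ M.E
  · change (projGen 𝕜 M i x : A 𝕜 M) ∈ grading 𝕜 M 1
    rw [coe_projGen 𝕜 h.2 h.1]
    exact sub_mem (genOn_mem_grading _) (genOn_mem_grading _)
  · rw [projGen, dif_neg h]
    exact zero_mem _

/-- Inside `A 𝕜 M` this is the translation of the generators by `-e_i`; the relations descend along
the injective inclusion. -/
theorem isOSFamily_projGen (hi : i ∈ M.E) : IsOSFamily M (projGen 𝕜 M i) := by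
  have h := isOSFamily_genOn 𝕜 M
  refine IsOSFamily.of_map (F := (projective 𝕜 M).val.toRingHom) Subtype.val_injective ?_
  refine (h.add_const (w := -genOn 𝕜 M i) ?_ ?_).congr fun x hx => ?_
  · rw [neg_mul_neg, h.sq i hi]
  · intro x hx
    rw [neg_mul, mul_neg, h.anticomm i hi x hx]
  · rw [← sub_eq_add_neg]
    exact (coe_projGen 𝕜 hi hx).symm

/-- Two homomorphisms that agree on the differences `e_x - e_i` agree on the projective
algebra. -/
theorem eq_of_eq_projGen {B : Type*} [Semiring B] [Algebra 𝕜 B] (hi : i ∈ M.E)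
    {F G : projective 𝕜 M →ₐ[𝕜] B} (h : ∀ x ∈ M.E, F (projGen 𝕜 M i x) = G (projGen 𝕜 M i x)) :
    F = G := by
  have key : ∀ (a : A 𝕜 M) (ha : a ∈ projective 𝕜 M), F ⟨a, ha⟩ = G ⟨a, ha⟩ := by
    intro a ha
    have ha' := ha
    rw [projective_eq_adjoin ⟨i, hi⟩] at ha'
    have hle : Algebra.adjoin 𝕜 (Set.range fun x => gen 𝕜 M x - gen 𝕜 M ⟨i, hi⟩) ≤
        (AlgHom.equalizer F G).map (projective 𝕜 M).val := by
      refine Algebra.adjoin_le ?_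
      rintro _ ⟨x, rfl⟩
      refine ⟨projGen 𝕜 M i x, h x x.2, ?_⟩
      change (projGen 𝕜 M i x : A 𝕜 M) = _
      rw [coe_projGen 𝕜 hi x.2, genOn_coe, genOn_of_mem hi]
    obtain ⟨b, hb, rfl⟩ := hle ha'
    exact hb
  exact AlgHom.ext fun a => key a a.2

theorem map_projective_le {M' : Matroid α} {F : A 𝕜 M →ₐ[𝕜] A 𝕜 M'} (hi : i ∈ M.E)
    (hM : M.E ⊆ M'.E) (hF : ∀ x : M.E, F (gen 𝕜 M x) = genOn 𝕜 M' x) {a : A 𝕜 M}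
    (ha : a ∈ projective 𝕜 M) : F a ∈ projective 𝕜 M' := by
  have hle : Algebra.adjoin 𝕜 (Set.range fun x => gen 𝕜 M x - gen 𝕜 M ⟨i, hi⟩) ≤
      (projective 𝕜 M').comap F := by
    refine Algebra.adjoin_le ?_
    rintro _ ⟨x, rfl⟩
    change F (gen 𝕜 M x - gen 𝕜 M ⟨i, hi⟩) ∈ projective 𝕜 M'
    rw [map_sub, hF, hF]
    exact genOn_sub_mem_projective 𝕜 (hM hi) (hM x.2)
  rw [projective_eq_adjoin ⟨i, hi⟩] at ha
  exact hle ha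

end Projective

/-! ### The graded tensor product isomorphism -/

section TensorProduct

variable (𝕜 : Type v) [Field 𝕜] {α : Type u} {M₁ M₂ : Matroid α} {i : α}

open Classical in
/-- The images of the generators under the inverse homomorphism: `(e_x - e_i) ⊗ 1` or
`1 ⊗ (e_x - e_i)`. -/
noncomputable def tensorFamily (M₁ M₂ : Matroid α) (i x : α) :
    projGrading 𝕜 M₁ ᵍ⊗[𝕜] projGrading 𝕜 M₂ :=
  if x ∈ M₁.E then GradedTensorProduct.includeLeft _ _ (projGen 𝕜 M₁ i x)
  else GradedTensorProduct.includeRight _ _ (projGen 𝕜 M₂ i x)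

theorem tensorFamily_left {x : α} (hx : x ∈ M₁.E) :
    tensorFamily 𝕜 M₁ M₂ i x = GradedTensorProduct.includeLeft _ _ (projGen 𝕜 M₁ i x) :=
  if_pos hx

/-- At the shared element both candidates vanish, because `e_i - e_i = 0`. -/
theorem tensorFamily_right (hE : M₁.E ∩ M₂.E = {i}) {x : α} (hx : x ∈ M₂.E) :
    tensorFamily 𝕜 M₁ M₂ i x = GradedTensorProduct.includeRight _ _ (projGen 𝕜 M₂ i x) := by
  by_cases h : x ∈ M₁.E
  · obtain rfl := ParallelConnection.eq_of_mem_of_mem hE h hx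
    rw [tensorFamily_left 𝕜 h, projGen_self 𝕜 h, projGen_self 𝕜 hx, map_zero, map_zero]
  · exact if_neg h

theorem includeLeft_mul_includeRight_anticomm (x y : α) :
    GradedTensorProduct.includeLeft (projGrading 𝕜 M₁) (projGrading 𝕜 M₂) (projGen 𝕜 M₁ i x) *
        GradedTensorProduct.includeRight _ _ (projGen 𝕜 M₂ i y) =
      -(GradedTensorProduct.includeRight _ _ (projGen 𝕜 M₂ i y) *
        GradedTensorProduct.includeLeft _ _ (projGen 𝕜 M₁ i x)) := by
  have h := GradedTensorProduct.tmul_coe_mul_coe_tmul (R := 𝕜) (projGrading 𝕜 M₁)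
    (projGrading 𝕜 M₂) 1 ⟨_, projGen_mem_projGrading 𝕜 (M := M₂) (i := i) y⟩
    ⟨_, projGen_mem_projGrading 𝕜 (M := M₁) (i := i) x⟩ 1
  have h' := GradedTensorProduct.tmul_one_mul_one_tmul (R := 𝕜) (projGrading 𝕜 M₁)
    (projGrading 𝕜 M₂) (projGen 𝕜 M₁ i x) (projGen 𝕜 M₂ i y)
  simp only [one_mul, mul_one, uzpow_one, Units.neg_smul, one_smul] at h
  simp only [GradedTensorProduct.includeLeft_apply, GradedTensorProduct.includeRight_apply]
  rw [h, h', neg_neg]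

variable [M₁.Finite] [M₂.Finite]
  (hE : M₁.E ∩ M₂.E = {i}) (h₁ : M₁.IsNonloop i) (h₂ : M₂.IsNonloop i)

/-- The homomorphism from `A(M₁)` to the algebra of the parallel connection. -/
noncomputable def mapLeft : A 𝕜 M₁ →ₐ[𝕜] A 𝕜 (parallelConnection M₁ M₂ i hE h₁ h₂) :=
  ((isOSFamily_parallelConnection_iff hE h₁ h₂).1 (isOSFamily_genOn 𝕜 _)).1.lift

/-- The homomorphism from `A(M₂)` to the algebra of the parallel connection. -/
noncomputable def mapRight : A 𝕜 M₂ →ₐ[𝕜] A 𝕜 (parallelConnection M₁ M₂ i hE h₁ h₂) :=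
  ((isOSFamily_parallelConnection_iff hE h₁ h₂).1 (isOSFamily_genOn 𝕜 _)).2.1.lift

theorem mapLeft_gen (x : M₁.E) : mapLeft 𝕜 hE h₁ h₂ (gen 𝕜 M₁ x) =
      genOn 𝕜 (parallelConnection M₁ M₂ i hE h₁ h₂) x :=
  IsOSFamily.lift_gen _ x

theorem mapRight_gen (x : M₂.E) : mapRight 𝕜 hE h₁ h₂ (gen 𝕜 M₂ x) =
      genOn 𝕜 (parallelConnection M₁ M₂ i hE h₁ h₂) x :=
  IsOSFamily.lift_gen _ x

theorem mapLeft_mem_grading {n : ℕ} {a : A 𝕜 M₁} (ha : a ∈ grading 𝕜 M₁ n) :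
    mapLeft 𝕜 hE h₁ h₂ a ∈ grading 𝕜 (parallelConnection M₁ M₂ i hE h₁ h₂) n :=
  IsOSFamily.lift_mem _ (grading 𝕜 (parallelConnection M₁ M₂ i hE h₁ h₂))
    (fun x _ => genOn_mem_grading x) ha

theorem mapRight_mem_grading {n : ℕ} {a : A 𝕜 M₂} (ha : a ∈ grading 𝕜 M₂ n) :
    mapRight 𝕜 hE h₁ h₂ a ∈ grading 𝕜 (parallelConnection M₁ M₂ i hE h₁ h₂) n :=
  IsOSFamily.lift_mem _ (grading 𝕜 (parallelConnection M₁ M₂ i hE h₁ h₂))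
    (fun x _ => genOn_mem_grading x) ha

/-- The restriction of `mapLeft` to the projective algebras. -/
noncomputable def projMapLeft :
    projective 𝕜 M₁ →ₐ[𝕜] projective 𝕜 (parallelConnection M₁ M₂ i hE h₁ h₂) :=
  ((mapLeft 𝕜 hE h₁ h₂).comp (projective 𝕜 M₁).val).codRestrict _ fun a =>
    map_projective_le 𝕜 h₁.mem_ground Set.subset_union_left (mapLeft_gen 𝕜 hE h₁ h₂) a.2

/-- The restriction of `mapRight` to the projective algebras. -/
noncomputable def projMapRight :
    projective 𝕜 M₂ →ₐ[𝕜] projective 𝕜 (parallelConnection M₁ M₂ i hE h₁ h₂) :=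
  ((mapRight 𝕜 hE h₁ h₂).comp (projective 𝕜 M₂).val).codRestrict _ fun a =>
    map_projective_le 𝕜 h₂.mem_ground Set.subset_union_right (mapRight_gen 𝕜 hE h₁ h₂) a.2

theorem coe_projMapLeft (a : projective 𝕜 M₁) :
    (projMapLeft 𝕜 hE h₁ h₂ a : A 𝕜 (parallelConnection M₁ M₂ i hE h₁ h₂)) =
      mapLeft 𝕜 hE h₁ h₂ a := rfl

theorem coe_projMapRight (a : projective 𝕜 M₂) :
    (projMapRight 𝕜 hE h₁ h₂ a : A 𝕜 (parallelConnection M₁ M₂ i hE h₁ h₂)) =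
      mapRight 𝕜 hE h₁ h₂ a := rfl

theorem projMapLeft_projGen {x : α} (hx : x ∈ M₁.E) :
    projMapLeft 𝕜 hE h₁ h₂ (projGen 𝕜 M₁ i x) = projGen 𝕜 _ i x := by
  have hi := h₁.mem_ground
  refine Subtype.ext ?_
  rw [coe_projMapLeft, coe_projGen 𝕜 hi hx, coe_projGen 𝕜 (Or.inl hi) (Or.inl hx), map_sub,
    genOn_of_mem hx, genOn_of_mem hi, mapLeft_gen, mapLeft_gen]

theorem projMapRight_projGen {x : α} (hx : x ∈ M₂.E) :
    projMapRight 𝕜 hE h₁ h₂ (projGen 𝕜 M₂ i x) = projGen 𝕜 _ i x := by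
  have hi := h₂.mem_ground
  refine Subtype.ext ?_
  rw [coe_projMapRight, coe_projGen 𝕜 hi hx, coe_projGen 𝕜 (Or.inr hi) (Or.inr hx), map_sub,
    genOn_of_mem hx, genOn_of_mem hi, mapRight_gen, mapRight_gen]

/-- The homomorphism `a ⊗ b ↦ f₁(a) f₂(b)`. -/
noncomputable def tensorToProj :
    (projGrading 𝕜 M₁ ᵍ⊗[𝕜] projGrading 𝕜 M₂) →ₐ[𝕜]
      projective 𝕜 (parallelConnection M₁ M₂ i hE h₁ h₂) :=
  GradedTensorProduct.lift _ _ (projMapLeft 𝕜 hE h₁ h₂) (projMapRight 𝕜 hE h₁ h₂) (by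
    intro m n a b
    refine Subtype.ext ?_
    -- The compatibility required of the two maps is the Koszul sign rule between their images,
    -- which is graded commutativity of the target.
    have h := mul_comm_of_mem_grading (mapLeft_mem_grading 𝕜 hE h₁ h₂ a.2)
      (mapRight_mem_grading 𝕜 hE h₁ h₂ b.2)
    rw [Units.smul_def, zsmul_eq_mul]
    push_cast
    exact h)

theorem tensorToProj_tmul (a : projective 𝕜 M₁) (b : projective 𝕜 M₂) :
    tensorToProj 𝕜 hE h₁ h₂ (GradedTensorProduct.tmul 𝕜 a b) =
      projMapLeft 𝕜 hE h₁ h₂ a * projMapRight 𝕜 hE h₁ h₂ b := rfl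

theorem isOSFamily_tensorFamily :
    IsOSFamily (parallelConnection M₁ M₂ i hE h₁ h₂) (tensorFamily 𝕜 M₁ M₂ i) := by
  refine (isOSFamily_parallelConnection_iff hE h₁ h₂).2 ⟨?_, ?_, ?_⟩
  · exact ((isOSFamily_projGen 𝕜 h₁.mem_ground).map
      (GradedTensorProduct.includeLeft (projGrading 𝕜 M₁) (projGrading 𝕜 M₂)).toRingHom).congr
      fun x hx => (tensorFamily_left 𝕜 hx).symm
  · exact ((isOSFamily_projGen 𝕜 h₂.mem_ground).map
      (GradedTensorProduct.includeRight (projGrading 𝕜 M₁) (projGrading 𝕜 M₂)).toRingHom).congr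
      fun x hx => (tensorFamily_right 𝕜 hE hx).symm
  · intro x hx y hy
    rw [tensorFamily_left 𝕜 hx, tensorFamily_right 𝕜 hE hy, includeLeft_mul_includeRight_anticomm]

/-- The inverse of `tensorToProj`. -/
noncomputable def projToTensor :
    projective 𝕜 (parallelConnection M₁ M₂ i hE h₁ h₂) →ₐ[𝕜]
      (projGrading 𝕜 M₁ ᵍ⊗[𝕜] projGrading 𝕜 M₂) :=
  ((isOSFamily_tensorFamily 𝕜 hE h₁ h₂).lift (𝕜 := 𝕜)).comp (projective 𝕜 _).val

/-- The lift kills `e_i`, so `e_x - e_i` has the same image as `e_x`. -/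
theorem projToTensor_projGen {x : α} (hx : x ∈ (parallelConnection M₁ M₂ i hE h₁ h₂).E) :
    projToTensor 𝕜 hE h₁ h₂ (projGen 𝕜 _ i x) = tensorFamily 𝕜 M₁ M₂ i x := by
  have hi : i ∈ (parallelConnection M₁ M₂ i hE h₁ h₂).E := Or.inl h₁.mem_ground
  change IsOSFamily.lift (𝕜 := 𝕜) (isOSFamily_tensorFamily 𝕜 hE h₁ h₂)
    (projGen 𝕜 (parallelConnection M₁ M₂ i hE h₁ h₂) i x : A 𝕜 _) = _
  rw [coe_projGen 𝕜 hi hx, map_sub, genOn_of_mem hx, genOn_of_mem hi, IsOSFamily.lift_gen,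
    IsOSFamily.lift_gen, tensorFamily_left 𝕜 h₁.mem_ground, projGen_self 𝕜 h₁.mem_ground,
    map_zero, sub_zero]

/-- The projective algebra of the parallel connection is the graded tensor product of the
projective algebras. -/
noncomputable def tensorEquivProj :
    (projGrading 𝕜 M₁ ᵍ⊗[𝕜] projGrading 𝕜 M₂) ≃ₐ[𝕜]
      projective 𝕜 (parallelConnection M₁ M₂ i hE h₁ h₂) :=
  AlgEquiv.ofAlgHom (tensorToProj 𝕜 hE h₁ h₂) (projToTensor 𝕜 hE h₁ h₂)
    (eq_of_eq_projGen 𝕜 (M := parallelConnection M₁ M₂ i hE h₁ h₂) (i := i)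
      (Or.inl h₁.mem_ground) fun x hx => by
      rw [AlgHom.comp_apply, projToTensor_projGen 𝕜 hE h₁ h₂ hx, AlgHom.id_apply]
      rcases hx with hx | hx
      · rw [tensorFamily_left 𝕜 hx, GradedTensorProduct.includeLeft_apply, tensorToProj_tmul,
          map_one, mul_one, projMapLeft_projGen _ _ _ _ hx]
      · rw [tensorFamily_right 𝕜 hE hx, GradedTensorProduct.includeRight_apply, tensorToProj_tmul,
          map_one, one_mul, projMapRight_projGen _ _ _ _ hx])
    (by
      refine GradedTensorProduct.algHom_ext _ _ (eq_of_eq_projGen 𝕜 h₁.mem_ground fun x hx => ?_)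
        (eq_of_eq_projGen 𝕜 h₂.mem_ground fun x hx => ?_)
      · simp only [AlgHom.comp_apply, AlgHom.id_apply]
        rw [GradedTensorProduct.includeLeft_apply, tensorToProj_tmul, map_one, mul_one,
          projMapLeft_projGen _ _ _ _ hx, projToTensor_projGen _ _ _ _ (Or.inl hx),
          tensorFamily_left 𝕜 hx, GradedTensorProduct.includeLeft_apply]
      · simp only [AlgHom.comp_apply, AlgHom.id_apply]
        rw [GradedTensorProduct.includeRight_apply, tensorToProj_tmul, map_one, one_mul,
          projMapRight_projGen _ _ _ _ hx, projToTensor_projGen _ _ _ _ (Or.inr hx),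
          tensorFamily_right 𝕜 hE hx, GradedTensorProduct.includeRight_apply])

end TensorProduct

end OrlikSolomon

/-! ### The main theorem -/

theorem mainTheorem9 (𝕜 : Type v) [Field 𝕜] {α : Type u} (M₁ M₂ : Matroid α)
    [M₁.Finite] [M₂.Finite] (i : α) (hE : M₁.E ∩ M₂.E = {i})
    (h₁ : M₁.IsNonloop i) (h₂ : M₂.IsNonloop i) :
    -- the short exact sequence of graded vector spaces
    (∃ (Aφ : OrlikSolomon.A 𝕜 (M₁.sum M₂) →ₐ[𝕜]
          OrlikSolomon.A 𝕜 (parallelConnection M₁ M₂ i hE h₁ h₂))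
        (j : OrlikSolomon.A 𝕜 (parallelConnection M₁ M₂ i hE h₁ h₂) →ₗ[𝕜]
          OrlikSolomon.A 𝕜 (M₁.sum M₂)),
      (∀ x : (M₁.sum M₂).E, Aφ (OrlikSolomon.gen 𝕜 (M₁.sum M₂) x) =
        OrlikSolomon.gen 𝕜 (parallelConnection M₁ M₂ i hE h₁ h₂)
          (ParallelConnection.identify hE h₁ h₂ x)) ∧
      (∀ n, ∀ a ∈ OrlikSolomon.grading 𝕜 (M₁.sum M₂) n,
        Aφ a ∈ OrlikSolomon.grading 𝕜 (parallelConnection M₁ M₂ i hE h₁ h₂) n) ∧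
      (∀ n, ∀ b ∈ OrlikSolomon.grading 𝕜 (parallelConnection M₁ M₂ i hE h₁ h₂) n,
        j b ∈ OrlikSolomon.grading 𝕜 (M₁.sum M₂) (n + 1)) ∧
      (∀ a, j (Aφ a) =
        (OrlikSolomon.gen 𝕜 (M₁.sum M₂) (ParallelConnection.sumLeft M₂ ⟨i, h₁.mem_ground⟩) -
          OrlikSolomon.gen 𝕜 (M₁.sum M₂) (ParallelConnection.sumRight M₁ ⟨i, h₂.mem_ground⟩)) *
            a) ∧
      Function.Injective j ∧ Function.Exact j Aφ ∧ Function.Surjective Aφ) ∧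
    -- the isomorphism of graded algebras
    (∃ (f₁ : OrlikSolomon.A 𝕜 M₁ →ₐ[𝕜]
          OrlikSolomon.A 𝕜 (parallelConnection M₁ M₂ i hE h₁ h₂))
        (f₂ : OrlikSolomon.A 𝕜 M₂ →ₐ[𝕜]
          OrlikSolomon.A 𝕜 (parallelConnection M₁ M₂ i hE h₁ h₂))
        (ψ : (OrlikSolomon.projGrading 𝕜 M₁ ᵍ⊗[𝕜] OrlikSolomon.projGrading 𝕜 M₂) ≃ₐ[𝕜]
          OrlikSolomon.projective 𝕜 (parallelConnection M₁ M₂ i hE h₁ h₂)),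
      (∀ x : M₁.E, f₁ (OrlikSolomon.gen 𝕜 M₁ x) =
        OrlikSolomon.gen 𝕜 (parallelConnection M₁ M₂ i hE h₁ h₂)
          (ParallelConnection.inclLeft hE h₁ h₂ x)) ∧
      (∀ x : M₂.E, f₂ (OrlikSolomon.gen 𝕜 M₂ x) =
        OrlikSolomon.gen 𝕜 (parallelConnection M₁ M₂ i hE h₁ h₂)
          (ParallelConnection.inclRight hE h₁ h₂ x)) ∧
      (∀ (a : OrlikSolomon.projective 𝕜 M₁) (b : OrlikSolomon.projective 𝕜 M₂),
        (ψ (GradedTensorProduct.tmul 𝕜 a b) :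
          OrlikSolomon.A 𝕜 (parallelConnection M₁ M₂ i hE h₁ h₂)) = f₁ a * f₂ b) ∧
      (∀ p q, ∀ a ∈ OrlikSolomon.projGrading 𝕜 M₁ p,
        ∀ b ∈ OrlikSolomon.projGrading 𝕜 M₂ q,
          ψ (GradedTensorProduct.tmul 𝕜 a b) ∈
            OrlikSolomon.projGrading 𝕜 (parallelConnection M₁ M₂ i hE h₁ h₂) (p + q))) := by
  open OrlikSolomon in
  refine ⟨⟨mapIdentify 𝕜 hE h₁ h₂,
    (LinearMap.mulLeft 𝕜 (genDiff 𝕜 M₁ M₂ i)).comp (sectionHom 𝕜 hE h₁ h₂).toLinearMap,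
    ?_, ?_, ?_, ?_, ?_, ?_, ?_⟩, mapLeft 𝕜 hE h₁ h₂, mapRight 𝕜 hE h₁ h₂,
    tensorEquivProj 𝕜 hE h₁ h₂, ?_, ?_, ?_, ?_⟩
  · intro x
    rw [mapIdentify, IsOSFamily.lift_gen, ← genOn_coe]
    obtain ⟨x | x, hx⟩ := x <;> rfl
  · intro n a ha
    refine IsOSFamily.lift_mem _ (grading 𝕜 (parallelConnection M₁ M₂ i hE h₁ h₂)) ?_ ha
    rintro (x | x) _ <;> exact genOn_mem_grading x
  · intro n b hb
    rw [add_comm]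
    refine SetLike.GradedMul.mul_mem (A := grading 𝕜 (M₁.sum M₂))
      (sub_mem (genOn_mem_grading _) (genOn_mem_grading _)) ?_
    refine IsOSFamily.lift_mem _ (grading 𝕜 (M₁.sum M₂)) (fun x _ => ?_) hb
    rw [sectionFamily]
    split_ifs
    · exact genOn_mem_grading _
    · exact add_mem (genOn_mem_grading _) (sub_mem (genOn_mem_grading _) (genOn_mem_grading _))
  · intro a
    refine (genDiff_mul_sectionHom 𝕜 hE h₁ h₂ a).trans ?_
    rw [genDiff, genOn_of_mem (inl_mem_sum h₁.mem_ground), genOn_of_mem (inr_mem_sum h₂.mem_ground)]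
    rfl
  -- If `u * s b = 0` then `s b` is a multiple of `u`, and `A(φ)` sends it both to `b` and to `0`.
  · refine (injective_iff_map_eq_zero _).2 fun b hb => ?_
    obtain ⟨a, ha⟩ := exists_eq_genDiff_mul 𝕜 h₁.mem_ground h₂.mem_ground
      (show genDiff 𝕜 M₁ M₂ i * sectionHom 𝕜 hE h₁ h₂ b = 0 from hb)
    rw [← mapIdentify_sectionHom 𝕜 hE h₁ h₂ b, ha, map_mul, mapIdentify_genDiff, zero_mul]
  · intro a
    constructor
    · intro ha
      -- For `a` in the kernel, `u * a = u * s(A(φ) a) = 0`, so `a = u * b = j(A(φ) b)` for some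
      -- `b`.
      have h : genDiff 𝕜 M₁ M₂ i * a = 0 := by
        rw [← genDiff_mul_sectionHom 𝕜 hE h₁ h₂, ha, map_zero, mul_zero]
      obtain ⟨b, rfl⟩ := exists_eq_genDiff_mul 𝕜 h₁.mem_ground h₂.mem_ground h
      exact ⟨mapIdentify 𝕜 hE h₁ h₂ b, genDiff_mul_sectionHom 𝕜 hE h₁ h₂ b⟩
    · rintro ⟨b, rfl⟩
      change mapIdentify 𝕜 hE h₁ h₂ (genDiff 𝕜 M₁ M₂ i * _) = 0
      rw [map_mul, mapIdentify_genDiff, zero_mul]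
  · exact fun b => ⟨_, mapIdentify_sectionHom 𝕜 hE h₁ h₂ b⟩
  · intro x
    rw [mapLeft_gen]
    exact genOn_of_mem (Or.inl x.2)
  · intro x
    rw [mapRight_gen]
    exact genOn_of_mem (Or.inr x.2)
  · exact fun a b => rfl
  · intro p q a ha b hb
    exact SetLike.GradedMul.mul_mem
      (A := grading 𝕜 (parallelConnection M₁ M₂ i hE h₁ h₂))
      (mapLeft_mem_grading 𝕜 hE h₁ h₂ ha) (mapRight_mem_grading 𝕜 hE h₁ h₂ hb)
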